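/- Let $n\ge 1$. A weight on $\mathbb R^n$ is a measurable function that is positive and finite almost everywhere; $Q$ denotes cubes in $\mathbb R^n$ with sides parallel to the axes, and $p'$ is the dual exponent, $1/p+1/p'=1$. For $1<p\le q<\infty$, a weight $w$ belongs to $A_{p,q}$ if $$[w]_{A_{p,q}}=\sup_Q\Big(\frac1{|Q|}\int_Q w^q\,dx\Big)\Big(\frac1{|Q|}\int_Q w^{-p'}\,dx\Big)^{q/p'}<\infty ,$$ and for $1\le q<\infty$ it belongs to $A_{1,q}$ if there is a finite constant $C$ with $\frac1{|Q|}\int_Q w^q\,dx\le C\,\operatorname{ess\,inf}_Q w^q$ for all $Q$; the smallest such $C$ is $[w]_{A_{1,q}}$. Theorem (sharp off-diagonal extrapolation). Let $1\le p_0\le q_0<\infty$, $\gamma>0$, $c>0$, and let $1<p\le q<\infty$ satisfy $$\frac1p-\frac1q=\frac1{p_0}-\frac1{q_0}.$$ There is a constant $C$, depending only on $n,p_0,q_0,p,q,\gamma,c$, such that the following holds. Let $T$ be an operator (not necessarily linear) defined on some class $\mathcal D$ of measurable real- or complex-valued functions on $\mathbb R^n$, with measurable functions on $\mathbb R^n$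 as values, and suppose that $$\|wTf\|_{L^{q_0}(\mathbb R^n)}\le c\,[w]_{A_{p_0,q_0}}^{\gamma}\,\|wf\|_{L^{p_0}(\mathbb R^n)}\qquad\text{for all } f\in\mathcal D \text{ and all } w\in A_{p_0,q_0}.$$ Then $$\|wTf\|_{L^{q}(\mathbb R^n)}\le C\,[w]_{A_{p,q}}^{\gamma\max\{1,\frac{q_0}{p_0'}\frac{p'}{q}\}}\,\|wf\|_{L^{p}(\mathbb R^n)}\qquad\text{for all } f\in\mathcal D \text{ and all } w\in A_{p,q},$$ where $q_0/p_0'=0$ if $p_0=1$. Norms may take the value $+\infty$; an inequality with infinite right-hand side is trivially true. -/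

import Mathlib

open MeasureTheory
open scoped ENNReal NNReal

noncomputable section

/-- The closed cube in `ℝⁿ` with sides parallel to the axes, lower corner `a` and side length `l`. -/
def cube {n : ℕ} (a : Fin n → ℝ) (l : ℝ) : Set (Fin n → ℝ) :=
  Set.Icc a (fun i => a i + l)

/-- The dual exponent `p' = p / (p - 1)`, only used for `1 < p`. -/
def dualExp (p : ℝ) : ℝ := p / (p - 1)

/-- A weight on `ℝⁿ`: a Lebesgue measurable function that is positive (and finite)
almost everywhere. -/
structure IsWeight {n : ℕ} (w : (Fin n → ℝ) → ℝ) : Prop where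
  aemeasurable : AEMeasurable w volume
  pos : ∀ᵐ x ∂(volume : Measure (Fin n → ℝ)), 0 < w x

/-- The constant `[w]_{A_{p,q}}` for `1 < p`: the supremum over all cubes `Q` of
`(⨍_Q w^q) (⨍_Q w^{-p'})^{q/p'}`. -/
def apqConstOfOneLT {n : ℕ} (p q : ℝ) (w : (Fin n → ℝ) → ℝ) : ℝ≥0∞ :=
  ⨆ (a : Fin n → ℝ) (l : ℝ) (_ : 0 < l),
    (⨍⁻ x in cube a l, ENNReal.ofReal (w x) ^ q ∂volume) *
      (⨍⁻ x in cube a l, ENNReal.ofReal (w x) ^ (-dualExp p) ∂volume) ^ (q / dualExp p)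

/-- The constant `[w]_{A_{1,q}}`: the smallest `C` with `⨍_Q w^q ≤ C ⬝ ess inf_Q w^q` for all
cubes `Q` (and `∞` if there is none). -/
def aOneqConst {n : ℕ} (q : ℝ) (w : (Fin n → ℝ) → ℝ) : ℝ≥0∞ :=
  sInf {C : ℝ≥0∞ | ∀ (a : Fin n → ℝ) (l : ℝ), 0 < l →
    (⨍⁻ x in cube a l, ENNReal.ofReal (w x) ^ q ∂volume) ≤
      C * essInf (fun x => ENNReal.ofReal (w x) ^ q) (volume.restrict (cube a l))}

open Classical in
/-- The constant `[w]_{A_{p,q}}`, for `1 ≤ p`. -/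
def apqConst {n : ℕ} (p q : ℝ) (w : (Fin n → ℝ) → ℝ) : ℝ≥0∞ :=
  if p = 1 then aOneqConst q w else apqConstOfOneLT p q w

/-- The class `A_{p,q}` of weights on `ℝⁿ`. -/
structure IsApq {n : ℕ} (p q : ℝ) (w : (Fin n → ℝ) → ℝ) : Prop where
  isWeight : IsWeight w
  const_lt_top : apqConst p q w < ∞

/-- The norm `‖w f‖_{L^p(ℝⁿ)}`, with value `∞` allowed. -/
def weightedNorm {n : ℕ} {𝕜 : Type*} [RCLike 𝕜] (p : ℝ) (w : (Fin n → ℝ) → ℝ)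
    (f : (Fin n → ℝ) → 𝕜) : ℝ≥0∞ :=
  eLpNorm (fun x => w x • f x) (ENNReal.ofReal p) volume

/-- `extrapExp p₀ q₀ p q = max {1, (q₀ / p₀') (p' / q)}`, for `1 ≤ p₀` and `1 < p`. Here
`1 / p₀' = 1 - 1 / p₀`, so that `q₀ / p₀' = 0` when `p₀ = 1` (`p₀' = ∞`). -/
def extrapExp (p₀ q₀ p q : ℝ) : ℝ :=
  max 1 (q₀ * (1 - 1 / p₀) * (dualExp p / q))

end

/-! Put s = 1/q + 1/p' = 1/q₀ + 1/p₀', r = qs = 1 + q/p' and r₀ = q₀s. A weight w is in A_{p,q}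
exactly when u = w^q is in A_r, with the same constant A. The operator enters only through F = |f|
and G = |Tf|, so the theorem concerns a pair (F, G). For a suitable S ∈ L¹ one builds a majorant Z ≥
S with ∫ Z ≤ C ∫ S such that V = w Z^{1/q₀ - 1/q} is in A_{p₀,q₀}. The hypothesis is applied to V,
and Hölder's inequality with Z leads back to the exponents (p, q)
(`lintegral_rpow_le_of_majorant_of_lt`, `lintegral_rpow_le_of_majorant_of_gt`).

If q < q₀, take S = (wF)^p and Z = K^r u, so that V^{q₀} = u K^{-(r₀-r)}. If q > q₀, take for S a
truncation of (wG)^q and Z = K^{r'} σ with σ = u^{-1/(r-1)}, so that V^{q₀} = u^{(r₀-1)/(r-1)}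
K^{(r-r₀)/(r-1)}. In both cases K is an A₁ weight made by Rubio de Francia iteration, in L^r(u) or
in L^{r'}(σ); its A₁ constant is a multiple of the bound for the maximal operator there
(`exists_hasA1Bound`).

Sharpness comes from Buckley's bound (`exists_lintegral_centMax_rpow_mul_le`): the operator norm is
at most C A^{1/(r-1)} on L^r(u), and at most C A on L^{r'}(σ) because σ has A_{r'} constant
A^{1/(r-1)}. The factorization estimates then bound the constant of V by a multiple of
A^{(r₀-1)/(r-1)} in the first case and of A in the second, which is the stated maximum. Buckley's
bound follows from Lerner's domination of the maximal operator by centred maximal operators for u dx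
and σ dx; by Besicovitch these are bounded uniformly in the measure. -/

/-! ### Centred maximal functions for arbitrary measures. -/

section MaximalFunction

open Metric

variable {n : ℕ}

/-- The maximal function over cubes centred at `x` with half side length a power of `2`, relative
to the measure `μ`. -/
noncomputable def centMax (μ : Measure (Fin n → ℝ)) (g : (Fin n → ℝ) → ℝ≥0∞)
    (x : Fin n → ℝ) : ℝ≥0∞ :=
  ⨆ k : ℤ, (∫⁻ y in closedBall x ((2 : ℝ) ^ k), g y ∂μ) / μ (closedBall x ((2 : ℝ) ^ k))

/-- Tonelli, applied to the indicator of the pairs of points at distance at most `r`. -/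
theorem measurable_lintegral_closedBall (μ : Measure (Fin n → ℝ)) [SFinite μ]
    {g : (Fin n → ℝ) → ℝ≥0∞} (hg : Measurable g) (r : ℝ) :
    Measurable fun x => ∫⁻ y in closedBall x r, g y ∂μ := by
  have h : ∀ x, ∫⁻ y in closedBall x r, g y ∂μ =
      ∫⁻ y, {z : (Fin n → ℝ) × (Fin n → ℝ) | dist z.2 z.1 ≤ r}.indicator
        (fun z => g z.2) (x, y) ∂μ := by
    intro x
    rw [← lintegral_indicator measurableSet_closedBall]
    rfl
  simp_rw [h]
  refine Measurable.lintegral_prod_right' (f := fun z => Set.indicator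
    {z : (Fin n → ℝ) × (Fin n → ℝ) | dist z.2 z.1 ≤ r} (fun z => g z.2) z) ?_
  exact (hg.comp measurable_snd).indicator
    (measurableSet_le (measurable_snd.dist measurable_fst) measurable_const)

theorem measurable_centMax (μ : Measure (Fin n → ℝ)) [SFinite μ]
    {g : (Fin n → ℝ) → ℝ≥0∞} (hg : Measurable g) : Measurable (centMax μ g) := by
  refine Measurable.iSup fun k => (measurable_lintegral_closedBall μ hg _).div ?_
  simpa using measurable_lintegral_closedBall μ (g := 1) measurable_one ((2 : ℝ) ^ k)

theorem div_le_centMax (μ : Measure (Fin n → ℝ)) (g : (Fin n → ℝ) → ℝ≥0∞) (x : Fin n → ℝ)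
    (k : ℤ) :
    (∫⁻ y in closedBall x ((2 : ℝ) ^ k), g y ∂μ) / μ (closedBall x ((2 : ℝ) ^ k)) ≤
      centMax μ g x :=
  le_iSup (fun k : ℤ => (∫⁻ y in closedBall x ((2 : ℝ) ^ k), g y ∂μ) /
    μ (closedBall x ((2 : ℝ) ^ k))) k

theorem mul_measure_le_of_lt_div {a b t : ℝ≥0∞} (h : t < a / b) : t * b ≤ a := by
  exact ENNReal.mul_le_of_le_div h.le

/-- Weak type `(1, 1)` bound, via the Besicovitch covering theorem. -/
theorem mul_measure_lt_centMax_le (μ : Measure (Fin n → ℝ)) (g : (Fin n → ℝ) → ℝ≥0∞)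
    (t : ℝ≥0∞) :
    t * μ {x | t < centMax μ g x} ≤
      (Besicovitch.multiplicity (Fin n → ℝ) : ℝ≥0∞) * ∫⁻ x, g x ∂μ := by
  set N := Besicovitch.multiplicity (Fin n → ℝ)
  -- The covering theorem needs bounded radii, so they are capped at 2^m first. The sets increase
  -- with m, so no measurability is needed in the limit.
  let S : ℕ → Set (Fin n → ℝ) := fun m => {x | ∃ k : ℤ, k ≤ m ∧
    t < (∫⁻ y in closedBall x ((2 : ℝ) ^ k), g y ∂μ) / μ (closedBall x ((2 : ℝ) ^ k))}
  have hS : {x | t < centMax μ g x} = ⋃ m, S m := by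
    ext x
    simp only [centMax, Set.mem_ofPred_eq, lt_iSup_iff, Set.mem_iUnion, S]
    constructor
    · rintro ⟨k, hk⟩
      exact ⟨k.toNat, k, Int.self_le_toNat k, hk⟩
    · rintro ⟨m, k, -, hk⟩
      exact ⟨k, hk⟩
  have hmono : Monotone S := by
    intro a b hab x
    rintro ⟨k, hk, h⟩
    exact ⟨k, hk.trans (by exact_mod_cast hab), h⟩
  rw [hS, hmono.measure_iUnion, ENNReal.mul_iSup]
  refine iSup_le fun m => ?_
  choose k hk hkt using fun x : S m => x.2
  let q : Besicovitch.BallPackage (S m) (Fin n → ℝ) :=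
    { c := fun x => x
      r := fun x => (2 : ℝ) ^ k x
      rpos := fun x => by positivity
      r_bound := (2 : ℝ) ^ (m : ℤ)
      r_le := fun x => zpow_le_zpow_right₀ (by norm_num) (hk x) }
  -- `N` families of pairwise disjoint balls that together cover all centres; `N` depends on n
  -- alone, not on `μ`.
  obtain ⟨s, hs, hcov⟩ := Besicovitch.exist_disjoint_covering_families
    (Besicovitch.one_lt_goodτ (Fin n → ℝ))
    (Besicovitch.isEmpty_satelliteConfig_multiplicity (Fin n → ℝ)) q
  have hcount : ∀ i, (s i).Countable := fun i =>
    (hs i).countable_of_nonempty_interior fun j _ =>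
      ⟨q.c j, ball_subset_interior_closedBall (mem_ball_self (q.rpos j))⟩
  have hsub : S m ⊆ ⋃ i : Fin N, ⋃ j ∈ s i, closedBall (q.c j) (q.r j) := by
    intro x hx
    have := hcov ⟨⟨x, hx⟩, rfl⟩
    simp only [Set.mem_iUnion] at this ⊢
    obtain ⟨i, j, hj, h⟩ := this
    exact ⟨i, j, hj, ball_subset_closedBall h⟩
  have hfam : ∀ i, t * μ (⋃ j ∈ s i, closedBall (q.c j) (q.r j)) ≤ ∫⁻ x, g x ∂μ := by
    intro i
    rw [measure_biUnion (hcount i) (hs i) fun j _ => measurableSet_closedBall,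
      ← ENNReal.tsum_mul_left]
    calc ∑' j : s i, t * μ (closedBall (q.c j) (q.r j))
        ≤ ∑' j : s i, ∫⁻ y in closedBall (q.c j) (q.r j), g y ∂μ :=
          ENNReal.tsum_le_tsum fun j => mul_measure_le_of_lt_div (hkt j)
      _ = ∫⁻ y in ⋃ j ∈ s i, closedBall (q.c j) (q.r j), g y ∂μ :=
          (lintegral_biUnion (hcount i) (fun j _ => measurableSet_closedBall) (hs i) _).symm
      _ ≤ ∫⁻ x, g x ∂μ := setLIntegral_le_lintegral _ _
  calc t * μ (S m) ≤ t * ∑ i : Fin N, μ (⋃ j ∈ s i, closedBall (q.c j) (q.r j)) := by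
        gcongr
        refine (measure_mono hsub).trans ?_
        simpa using measure_iUnion_fintype_le μ fun i => ⋃ j ∈ s i, closedBall (q.c j) (q.r j)
    _ = ∑ i : Fin N, t * μ (⋃ j ∈ s i, closedBall (q.c j) (q.r j)) := by rw [Finset.mul_sum]
    _ ≤ ∑ _i : Fin N, ∫⁻ x, g x ∂μ := Finset.sum_le_sum fun i _ => hfam i
    _ = N * ∫⁻ x, g x ∂μ := by simp

/-- The part of `g` below height `t` has averages at most `t`. This is the splitting used to
interpolate between weak type (1, 1) and L^∞. -/
theorem centMax_le_add (μ : Measure (Fin n → ℝ)) (g : (Fin n → ℝ) → ℝ≥0∞)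
    (t : ℝ≥0∞) (x : Fin n → ℝ) :
    centMax μ g x ≤ centMax μ ({y | t < g y}.indicator g) x + t := by
  refine iSup_le fun k => ?_
  have h : ∫⁻ y in closedBall x ((2 : ℝ) ^ k), g y ∂μ ≤
      (∫⁻ y in closedBall x ((2 : ℝ) ^ k), {y | t < g y}.indicator g y ∂μ) +
        t * μ (closedBall x ((2 : ℝ) ^ k)) := by
    rw [← setLIntegral_const, ← lintegral_add_right _ measurable_const]
    refine lintegral_mono fun y => ?_
    by_cases hy : t < g y
    · simp [hy]
    · simpa [hy] using not_lt.1 hy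
  calc _ ≤ ((∫⁻ y in closedBall x ((2 : ℝ) ^ k), {y | t < g y}.indicator g y ∂μ) +
        t * μ (closedBall x ((2 : ℝ) ^ k))) / μ (closedBall x ((2 : ℝ) ^ k)) := by gcongr
    _ ≤ _ := by
      rw [ENNReal.add_div]
      gcongr
      · exact div_le_centMax μ _ x k
      · exact ENNReal.div_le_of_le_mul le_rfl

theorem mul_measure_lt_centMax_le_setLIntegral (μ : Measure (Fin n → ℝ))
    (g : (Fin n → ℝ) → ℝ≥0∞) (t : ℝ≥0∞) :
    t * μ {x | t < centMax μ g x} ≤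
      2 * (Besicovitch.multiplicity (Fin n → ℝ) : ℝ≥0∞) *
        ∫⁻ x, {y | t < 2 * g y}.indicator g x ∂μ := by
  have h2 : {y | t < 2 * g y} = {y | t / 2 < g y} := by
    ext y
    simp only [Set.mem_ofPred_eq]
    rw [ENNReal.div_lt_iff (by simp) (by simp), mul_comm]
  have hsub : {x | t < centMax μ g x} ⊆
      {x | t / 2 < centMax μ ({y | t / 2 < g y}.indicator g) x} := by
    intro x hx
    have h := lt_of_lt_of_le (show t < centMax μ g x from hx) (centMax_le_add μ g (t / 2) x)
    by_contra hcon
    simp only [Set.mem_ofPred_eq, not_lt] at hcon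
    refine absurd h (not_lt.2 ?_)
    calc _ ≤ t / 2 + t / 2 := by gcongr
      _ = t := ENNReal.add_halves t
  calc t * μ {x | t < centMax μ g x}
      ≤ t * μ {x | t / 2 < centMax μ ({y | t / 2 < g y}.indicator g) x} := by gcongr
    _ = 2 * (t / 2 * μ {x | t / 2 < centMax μ ({y | t / 2 < g y}.indicator g) x}) := by
        rw [← mul_assoc, ENNReal.mul_div_cancel (by simp) (by simp)]
    _ ≤ _ := by
        rw [h2, mul_assoc]
        exact mul_le_mul_right (mul_measure_lt_centMax_le μ _ _) _

/-- The layer cake formula for powers of a number in `[0, ∞]`. -/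
theorem setLIntegral_Ioi_rpow_mul_indicator {q : ℝ} (hq : 0 < q) (x : ℝ≥0∞) :
    ∫⁻ t in Set.Ioi (0 : ℝ), {t : ℝ | ENNReal.ofReal t < x}.indicator
      (fun t => ENNReal.ofReal (t ^ (q - 1))) t = x ^ q / ENNReal.ofReal q := by
  have hfin : ∀ y : ℝ≥0, ∫⁻ t in Set.Ioi (0 : ℝ), {t : ℝ | ENNReal.ofReal t < (y : ℝ≥0∞)}.indicator
      (fun t => ENNReal.ofReal (t ^ (q - 1))) t = (y : ℝ≥0∞) ^ q / ENNReal.ofReal q := by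
    intro y
    have hms : MeasurableSet {t : ℝ | ENNReal.ofReal t < (y : ℝ≥0∞)} :=
      measurableSet_lt ENNReal.measurable_ofReal measurable_const
    rw [lintegral_indicator hms, Measure.restrict_restrict hms]
    have hset : {t : ℝ | ENNReal.ofReal t < (y : ℝ≥0∞)} ∩ Set.Ioi 0 = Set.Ioo 0 (y : ℝ) := by
      ext t
      simp only [Set.mem_inter_iff, Set.mem_ofPred_eq, Set.mem_Ioi, Set.mem_Ioo]
      constructor
      · rintro ⟨h1, h2⟩
        refine ⟨h2, ?_⟩
        rw [← ENNReal.ofReal_coe_nnreal] at h1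
        exact (ENNReal.ofReal_lt_ofReal_iff_of_nonneg h2.le).1 h1
      · rintro ⟨h1, h2⟩
        refine ⟨?_, h1⟩
        rw [← ENNReal.ofReal_coe_nnreal]
        exact (ENNReal.ofReal_lt_ofReal_iff_of_nonneg h1.le).2 h2
    have hint := (intervalIntegrable_iff_integrableOn_Ioc_of_le y.coe_nonneg).1
      (intervalIntegral.intervalIntegrable_rpow' (a := 0) (b := (y : ℝ))
        (r := q - 1) (by linarith))
    rw [hset, restrict_Ioo_eq_restrict_Ioc, ← ofReal_integral_eq_lintegral_ofReal hint,
      ← intervalIntegral.integral_of_le y.coe_nonneg, integral_rpow (Or.inl (by linarith)),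
      ENNReal.ofReal_div_of_pos (by linarith)]
    · simp only [sub_add_cancel, Real.zero_rpow hq.ne', sub_zero]
      rw [← ENNReal.ofReal_rpow_of_nonneg y.coe_nonneg hq.le, ENNReal.ofReal_coe_nnreal]
    · filter_upwards [ae_restrict_mem measurableSet_Ioc] with t ht
      exact Real.rpow_nonneg ht.1.le _
  induction x with
  | coe y => exact hfin y
  | top =>
    rw [ENNReal.top_rpow_of_pos hq, ENNReal.top_div_of_ne_top ENNReal.ofReal_ne_top]
    refine ENNReal.eq_top_of_forall_nnreal_le fun r => ?_
    have hq0 : ENNReal.ofReal q ≠ 0 := by simpa using hq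
    -- Chosen so that y^q / q = r: the integral for x = ∞ exceeds every finite value.
    let y : ℝ≥0 := (r * q.toNNReal) ^ (1 / q)
    calc (r : ℝ≥0∞) = (y : ℝ≥0∞) ^ q / ENNReal.ofReal q := by
          rw [← ENNReal.coe_rpow_of_nonneg _ hq.le, ← NNReal.rpow_mul, one_div,
            inv_mul_cancel₀ hq.ne', NNReal.rpow_one, ENNReal.coe_mul]
          exact (ENNReal.mul_div_cancel_right hq0 ENNReal.ofReal_ne_top).symm
      _ = _ := (hfin y).symm
      _ ≤ _ := by
          refine lintegral_mono fun t => ?_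
          refine Set.indicator_le_indicator_of_subset (fun t _ => ?_) (fun _ => zero_le) t
          exact ENNReal.ofReal_lt_top

/-- The strong type bound for the centred maximal function, with a constant independent of `μ`. -/
theorem lintegral_centMax_rpow_le (μ : Measure (Fin n → ℝ)) [SFinite μ] {p : ℝ} (hp : 1 < p)
    {g : (Fin n → ℝ) → ℝ≥0∞} (hg : Measurable g) :
    ∫⁻ x, centMax μ g x ^ p ∂μ ≤
      (ENNReal.ofReal p * (2 * (Besicovitch.multiplicity (Fin n → ℝ) : ℝ≥0∞)) *
        (2 ^ (p - 1) / ENNReal.ofReal (p - 1))) * ∫⁻ x, g x ^ p ∂μ := by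
  set N : ℝ≥0∞ := (Besicovitch.multiplicity (Fin n → ℝ) : ℝ≥0∞)
  have hM := measurable_centMax μ hg
  have hp0 : ENNReal.ofReal p ≠ 0 := by simp; linarith
  have hmeas : ∀ {F : (Fin n → ℝ) → ℝ≥0∞} {a : ℝ}, Measurable F →
      Measurable fun z : (Fin n → ℝ) × ℝ => {t : ℝ | ENNReal.ofReal t < F z.1}.indicator
        (fun t => ENNReal.ofReal (t ^ a)) z.2 := by
    intro F a hF
    have : (fun z : (Fin n → ℝ) × ℝ => {t : ℝ | ENNReal.ofReal t < F z.1}.indicator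
        (fun t => ENNReal.ofReal (t ^ a)) z.2) =
        {z : (Fin n → ℝ) × ℝ | ENNReal.ofReal z.2 < F z.1}.indicator
          (fun z => ENNReal.ofReal (z.2 ^ a)) := rfl
    rw [this]
    refine Measurable.indicator (by fun_prop) ?_
    exact measurableSet_lt (ENNReal.measurable_ofReal.comp measurable_snd)
      (hF.comp measurable_fst)
  -- The truncated weak type bound times t^{p-2}. Integrating in t under the x-integral produces g
  -- (2g)^{p-1} / (p-1); convergence at t = 0 uses p > 1.
  have key : ∀ t ∈ Set.Ioi (0 : ℝ),
      ∫⁻ x, {t : ℝ | ENNReal.ofReal t < centMax μ g x}.indicator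
        (fun t => ENNReal.ofReal (t ^ (p - 1))) t ∂μ ≤
      (2 * N) * ∫⁻ x, g x * {t : ℝ | ENNReal.ofReal t < 2 * g x}.indicator
        (fun t => ENNReal.ofReal (t ^ (p - 1 - 1))) t ∂μ := by
    intro t ht
    have h1 : ENNReal.ofReal (t ^ (p - 1)) = ENNReal.ofReal (t ^ (p - 1 - 1)) *
        ENNReal.ofReal t := by
      rw [← ENNReal.ofReal_mul (Real.rpow_nonneg (le_of_lt ht) _)]
      congr 1
      rw [← Real.rpow_add_one (ne_of_gt ht)]
      ring_nf
    have h2 : ∀ x, {t : ℝ | ENNReal.ofReal t < centMax μ g x}.indicator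
        (fun t => ENNReal.ofReal (t ^ (p - 1))) t =
        {x | ENNReal.ofReal t < centMax μ g x}.indicator
          (fun _ => ENNReal.ofReal (t ^ (p - 1))) x := fun x => rfl
    have h3 : ∀ x, g x * {t : ℝ | ENNReal.ofReal t < 2 * g x}.indicator
        (fun t => ENNReal.ofReal (t ^ (p - 1 - 1))) t =
        ENNReal.ofReal (t ^ (p - 1 - 1)) * {y | ENNReal.ofReal t < 2 * g y}.indicator g x := by
      intro x
      by_cases hx : ENNReal.ofReal t < 2 * g x
      · rw [Set.indicator_of_mem (Set.mem_ofPred_eq ▸ hx), Set.indicator_of_mem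
          (Set.mem_ofPred_eq ▸ hx), mul_comm]
      · simp [hx]
    simp_rw [h2, h3]
    rw [lintegral_indicator_const (measurableSet_lt measurable_const hM),
      lintegral_const_mul _ (hg.indicator (measurableSet_lt measurable_const (hg.const_mul 2))),
      h1, mul_assoc, mul_left_comm (2 * N)]
    refine mul_le_mul_right ?_ _
    exact mul_measure_lt_centMax_le_setLIntegral μ g _
  have hswap : ∫⁻ x, centMax μ g x ^ p ∂μ = ENNReal.ofReal p * ∫⁻ t in Set.Ioi (0 : ℝ),
      ∫⁻ x, {t : ℝ | ENNReal.ofReal t < centMax μ g x}.indicator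
        (fun t => ENNReal.ofReal (t ^ (p - 1))) t ∂μ := by
    rw [lintegral_lintegral_swap]
    · simp_rw [setLIntegral_Ioi_rpow_mul_indicator (show 0 < p by linarith)]
      simp_rw [div_eq_mul_inv]
      rw [lintegral_mul_const _ (hM.pow_const p), mul_left_comm,
        ENNReal.mul_inv_cancel hp0 ENNReal.ofReal_ne_top, mul_one]
    · exact ((hmeas hM).comp measurable_swap).aemeasurable
  rw [hswap]
  calc _ ≤ ENNReal.ofReal p * ∫⁻ t in Set.Ioi (0 : ℝ), (2 * N) *
        ∫⁻ x, g x * {t : ℝ | ENNReal.ofReal t < 2 * g x}.indicator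
          (fun t => ENNReal.ofReal (t ^ (p - 1 - 1))) t ∂μ := by
        refine mul_le_mul_right ?_ _
        exact setLIntegral_mono' measurableSet_Ioi key
    _ = ENNReal.ofReal p * ((2 * N) * ∫⁻ x, g x * ((2 * g x) ^ (p - 1) /
          ENNReal.ofReal (p - 1)) ∂μ) := by
        have hm2 : Measurable fun z : ℝ × (Fin n → ℝ) => g z.2 *
            {t : ℝ | ENNReal.ofReal t < 2 * g z.2}.indicator
              (fun t => ENNReal.ofReal (t ^ (p - 1 - 1))) z.1 :=
          (hg.comp measurable_snd).mul ((hmeas (hg.const_mul 2)).comp measurable_swap)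
        rw [lintegral_const_mul' _ _ (by finiteness), lintegral_lintegral_swap hm2.aemeasurable]
        congr 3
        ext x
        rw [lintegral_const_mul, setLIntegral_Ioi_rpow_mul_indicator (by linarith)]
        exact Measurable.indicator (by fun_prop)
          (measurableSet_lt ENNReal.measurable_ofReal measurable_const)
    _ = _ := by
        have hx : ∀ x, g x * ((2 * g x) ^ (p - 1) / ENNReal.ofReal (p - 1)) =
            (2 ^ (p - 1) / ENNReal.ofReal (p - 1)) * g x ^ p := by
          intro x
          rw [ENNReal.mul_rpow_of_nonneg _ _ (by linarith)]
          have : g x ^ p = g x * g x ^ (p - 1) := by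
            conv_rhs => enter [1]; rw [← ENNReal.rpow_one (g x)]
            rw [← ENNReal.rpow_add_of_nonneg _ _ (by norm_num) (by linarith)]
            ring_nf
          rw [this, div_eq_mul_inv, div_eq_mul_inv]
          ring
        simp_rw [hx]
        rw [lintegral_const_mul _ (hg.pow_const p)]
        ring

end MaximalFunction

/-! ### Buckley's sharp weighted bound, by Lerner's argument. -/

section Buckley

open Metric

variable {n : ℕ}

theorem ENNReal.rpow_ne_zero_of_ne {x : ℝ≥0∞} (h0 : x ≠ 0) (ht : x ≠ ∞) (a : ℝ) : x ^ a ≠ 0 :=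
  (ENNReal.rpow_pos h0.bot_lt ht).ne'

theorem ENNReal.rpow_ne_top_of_ne {x : ℝ≥0∞} (h0 : x ≠ 0) (ht : x ≠ ∞) (a : ℝ) : x ^ a ≠ ∞ :=
  ENNReal.rpow_ne_top_of_ne_zero h0 ht

theorem volume_closedBall_zpow_add_two (x : Fin n → ℝ) (k : ℤ) :
    volume (closedBall x ((2 : ℝ) ^ (k + 2))) = 4 ^ n * volume (closedBall x ((2 : ℝ) ^ k)) := by
  rw [Real.volume_pi_closedBall _ (by positivity), Real.volume_pi_closedBall _ (by positivity),
    zpow_add₀ (by norm_num)]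
  have h : (2 * ((2 : ℝ) ^ k * 2 ^ (2 : ℤ))) ^ Fintype.card (Fin n) =
      4 ^ n * (2 * (2 : ℝ) ^ k) ^ Fintype.card (Fin n) := by
    rw [Fintype.card_fin, ← mul_pow]
    norm_num
    ring
  rw [h, ENNReal.ofReal_mul (by positivity), ENNReal.ofReal_pow (by norm_num)]
  norm_num

theorem closedBall_zpow_subset {x z : Fin n → ℝ} {k : ℤ} (hz : z ∈ closedBall x ((2 : ℝ) ^ k)) :
    closedBall x ((2 : ℝ) ^ k) ⊆ closedBall z ((2 : ℝ) ^ (k + 1)) := by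
  refine closedBall_subset_closedBall' ?_
  rw [zpow_add_one₀ (by norm_num), dist_comm]
  rw [mem_closedBall] at hz
  linarith

theorem volume_closedBall_zpow_pos (x : Fin n → ℝ) (k : ℤ) :
    volume (closedBall x ((2 : ℝ) ^ k)) ≠ 0 :=
  (measure_closedBall_pos _ _ (by positivity)).ne'

theorem volume_closedBall_zpow_ne_top (x : Fin n → ℝ) (k : ℤ) :
    volume (closedBall x ((2 : ℝ) ^ k)) ≠ ∞ :=
  measure_closedBall_lt_top.ne

theorem setLIntegral_ne_zero_of_pos {u : (Fin n → ℝ) → ℝ≥0∞} (hu : Measurable u)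
    (hu0 : ∀ x, u x ≠ 0) {s : Set (Fin n → ℝ)} (hs : volume s ≠ 0) : ∫⁻ y in s, u y ≠ 0 := by
  have hpos := (lintegral_pos_iff_support (μ := volume.restrict s) hu).2
  refine (hpos ?_).ne'
  have : Function.support u = Set.univ := Set.eq_univ_of_forall hu0
  rw [this, Measure.restrict_apply_univ]
  exact hs.bot_lt

/-- Lerner's pointwise bound: the maximal function is controlled by the composition of two
weighted centred maximal functions. -/
theorem centMax_volume_le {u σ : (Fin n → ℝ) → ℝ≥0∞} (hu : Measurable u) (hσ : Measurable σ)
    (hu0 : ∀ x, u x ≠ 0) (hut : ∀ x, u x ≠ ∞) (hσ0 : ∀ x, σ x ≠ 0) (hσt : ∀ x, σ x ≠ ∞)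
    {r : ℝ} (hr : 1 < r) {A : ℝ≥0∞} (hA : A ≠ ∞)
    (h : ∀ (x : Fin n → ℝ) (k : ℤ), (∫⁻ y in closedBall x ((2 : ℝ) ^ k), u y) *
      (∫⁻ y in closedBall x ((2 : ℝ) ^ k), σ y) ^ (r - 1) ≤
        A * volume (closedBall x ((2 : ℝ) ^ k)) ^ r)
    {f : (Fin n → ℝ) → ℝ≥0∞} (hf : Measurable f) (x : Fin n → ℝ) :
    centMax volume f x ≤ (((4 ^ n) ^ r * A) * centMax (volume.withDensity u)
      (fun z => centMax (volume.withDensity σ) (fun y => f y / σ y) z ^ (r - 1) / u z) x) ^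
        (r - 1)⁻¹ := by
  have hr1 : 0 < r - 1 := by linarith
  set m := centMax (volume.withDensity σ) (fun y => f y / σ y) with hm
  set R := centMax (volume.withDensity u) (fun z => m z ^ (r - 1) / u z) x
  have hfσ : Measurable fun y => f y / σ y := hf.div hσ
  have hmm : Measurable m := measurable_centMax _ hfσ
  have hmu : Measurable fun z => m z ^ (r - 1) / u z := (hmm.pow_const _).div hu
  refine iSup_le fun k => ?_
  rw [ENNReal.le_rpow_inv_iff hr1]
  set B := closedBall x ((2 : ℝ) ^ k) with hB
  -- For z in `B`, the ball of radius 2^{k+1} about z contains `B` and lies in `B'`, since 1 + 2 ≤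
  -- 4. Hence `a` = ∫_B f / σ(B') is at most `m z` throughout `B`.
  set B' := closedBall x ((2 : ℝ) ^ (k + 2)) with hB'
  have hBB' : B ⊆ B' := closedBall_subset_closedBall
    (zpow_le_zpow_right₀ (by norm_num) (by linarith))
  have hB0 : volume B ≠ 0 := volume_closedBall_zpow_pos x k
  have hBt : volume B ≠ ∞ := volume_closedBall_zpow_ne_top x k
  have hU0 : ∫⁻ y in B', u y ≠ 0 :=
    setLIntegral_ne_zero_of_pos hu hu0 (volume_closedBall_zpow_pos x _)
  have hS0 : ∫⁻ y in B', σ y ≠ 0 :=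
    setLIntegral_ne_zero_of_pos hσ hσ0 (volume_closedBall_zpow_pos x _)
  have hUS : (∫⁻ y in B', u y) * (∫⁻ y in B', σ y) ^ (r - 1) ≠ ∞ := by
    refine ne_top_of_le_ne_top ?_ (h x (k + 2))
    exact ENNReal.mul_ne_top hA (ENNReal.rpow_ne_top_of_nonneg (by linarith)
      (volume_closedBall_zpow_ne_top x _))
  have hSt : ∫⁻ y in B', σ y ≠ ∞ := by
    intro hS
    rw [hS, ENNReal.top_rpow_of_pos hr1, ENNReal.mul_top hU0] at hUS
    exact hUS rfl
  have hUt : ∫⁻ y in B', u y ≠ ∞ := by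
    intro hS
    rw [hS, ENNReal.top_mul (ENNReal.rpow_ne_zero_of_ne hS0 hSt _)] at hUS
    exact hUS rfl
  set I := ∫⁻ y in B, f y
  set U' := ∫⁻ y in B', u y
  set S' := ∫⁻ y in B', σ y
  set a := I / S' with ha
  have haS : I = a * S' := (ENNReal.div_mul_cancel hS0 hSt).symm
  have ham : ∀ z ∈ B, a ≤ m z := by
    intro z hz
    refine le_trans ?_ (div_le_centMax _ _ z (k + 1))
    have hz' : closedBall z ((2 : ℝ) ^ (k + 1)) ⊆ B' := by
      refine closedBall_subset_closedBall' ?_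
      rw [hB, mem_closedBall] at hz
      rw [zpow_add_one₀ (by norm_num), zpow_add₀ (by norm_num)]
      have : (0 : ℝ) < 2 ^ k := by positivity
      norm_num
      linarith
    rw [ha]
    refine ENNReal.div_le_div ?_ ?_
    · rw [setLIntegral_withDensity_eq_setLIntegral_mul _ hσ hfσ measurableSet_closedBall]
      calc I = ∫⁻ y in B, (σ * fun y => f y / σ y) y := by
            refine lintegral_congr fun y => ?_
            simp only [Pi.mul_apply]
            rw [ENNReal.mul_div_cancel (hσ0 y) (hσt y)]
        _ ≤ _ := lintegral_mono_set (closedBall_zpow_subset hz)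
    · rw [withDensity_apply _ measurableSet_closedBall]
      exact lintegral_mono_set hz'
  -- Integrate the bound a ≤ m over `B`, writing dx as u⁻¹ · u dx; enlarging u(B) to u(B') in the
  -- denominator only lowers the average.
  have hJ : a ^ (r - 1) * volume B ≤ U' * R := by
    have h1 : a ^ (r - 1) * volume B ≤ ∫⁻ y in B, m y ^ (r - 1) / u y ∂volume.withDensity u := by
      rw [setLIntegral_withDensity_eq_setLIntegral_mul _ hu hmu
        measurableSet_closedBall, ← setLIntegral_const]
      refine setLIntegral_mono' measurableSet_closedBall fun y hy => ?_
      simp only [Pi.mul_apply]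
      rw [ENNReal.mul_div_cancel (hu0 y) (hut y)]
      exact ENNReal.rpow_le_rpow (ham y hy) hr1.le
    refine h1.trans ?_
    rw [mul_comm, ← ENNReal.div_le_iff hU0 hUt]
    refine le_trans ?_ (div_le_centMax _ _ x k)
    refine ENNReal.div_le_div le_rfl ?_
    rw [withDensity_apply _ measurableSet_closedBall]
    exact lintegral_mono_set hBB'
  have hBr0 : volume B ^ r ≠ 0 := ENNReal.rpow_ne_zero_of_ne hB0 hBt r
  have hBrt : volume B ^ r ≠ ∞ := ENNReal.rpow_ne_top_of_ne hB0 hBt r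
  have hBr : volume B ^ r = volume B * volume B ^ (r - 1) := by
    conv_rhs => enter [1]; rw [← ENNReal.rpow_one (volume B)]
    rw [← ENNReal.rpow_add _ _ hB0 hBt]
    ring_nf
  calc (I / volume B) ^ (r - 1)
      = (a ^ (r - 1) * volume B) * S' ^ (r - 1) / volume B ^ r := by
        rw [ENNReal.div_rpow_of_nonneg _ _ hr1.le, haS, ENNReal.mul_rpow_of_nonneg _ _ hr1.le, hBr,
          mul_right_comm, mul_comm (volume B)]
        exact (ENNReal.mul_div_mul_right _ _ hB0 hBt).symm
    _ ≤ (U' * R) * S' ^ (r - 1) / volume B ^ r := by gcongr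
    _ = (U' * S' ^ (r - 1)) * R / volume B ^ r := by rw [mul_right_comm]
    _ ≤ (A * volume B' ^ r) * R / volume B ^ r := by
        exact ENNReal.div_le_div_right (mul_le_mul_left (h x (k + 2)) _) _
    _ = ((4 ^ n) ^ r * A * R) * volume B ^ r / volume B ^ r := by
        rw [hB', volume_closedBall_zpow_add_two, ENNReal.mul_rpow_of_nonneg _ _ (by linarith)]
        congr 1
        ring
    _ = _ := ENNReal.mul_div_cancel_right hBr0 hBrt

/-- The constant in the strong type bound for the centred maximal function. -/
noncomputable def centMaxConst (n : ℕ) (p : ℝ) : ℝ≥0∞ :=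
  ENNReal.ofReal p * (2 * (Besicovitch.multiplicity (Fin n → ℝ) : ℝ≥0∞)) *
        (2 ^ (p - 1) / ENNReal.ofReal (p - 1))

theorem centMaxConst_ne_top (n : ℕ) {p : ℝ} (hp : 1 < p) : centMaxConst n p ≠ ∞ := by
  have h : ENNReal.ofReal (p - 1) ≠ 0 := by simpa using hp
  unfold centMaxConst
  refine ENNReal.mul_ne_top (by finiteness) (ENNReal.div_ne_top ?_ h)
  exact ENNReal.rpow_ne_top_of_nonneg (by linarith) (by simp)

/-- Buckley's sharp weighted bound for the maximal function. -/
theorem exists_lintegral_centMax_rpow_mul_le (n : ℕ) {r : ℝ} (hr : 1 < r) :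
    ∃ C : ℝ≥0∞, C ≠ ∞ ∧ ∀ (u σ : (Fin n → ℝ) → ℝ≥0∞), Measurable u → Measurable σ →
      (∀ x, u x ≠ 0) → (∀ x, u x ≠ ∞) → (∀ x, σ x = u x ^ (-(r - 1)⁻¹)) →
      ∀ A : ℝ≥0∞, A ≠ ∞ →
      (∀ (x : Fin n → ℝ) (k : ℤ), (∫⁻ y in closedBall x ((2 : ℝ) ^ k), u y) *
        (∫⁻ y in closedBall x ((2 : ℝ) ^ k), σ y) ^ (r - 1) ≤
          A * volume (closedBall x ((2 : ℝ) ^ k)) ^ r) →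
      ∀ f : (Fin n → ℝ) → ℝ≥0∞, Measurable f →
        ∫⁻ x, centMax volume f x ^ r * u x ≤ C * A ^ (r / (r - 1)) * ∫⁻ x, f x ^ r * u x := by
  have hr1 : 0 < r - 1 := by linarith
  have hr' : 1 < r / (r - 1) := by rw [one_lt_div hr1]; linarith
  refine ⟨((4 ^ n) ^ r) ^ (r / (r - 1)) * (centMaxConst n (r / (r - 1)) * centMaxConst n r),
    ENNReal.mul_ne_top ?_ (ENNReal.mul_ne_top (centMaxConst_ne_top n hr')
      (centMaxConst_ne_top n hr)), ?_⟩
  · exact ENNReal.rpow_ne_top_of_nonneg (by linarith)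
      (ENNReal.rpow_ne_top_of_nonneg (by linarith) (by finiteness))
  intro u σ hu hσ hu0 hut hσu A hA h f hf
  have hσ0 : ∀ x, σ x ≠ 0 := fun x => hσu x ▸ ENNReal.rpow_ne_zero_of_ne (hu0 x) (hut x) _
  have hσt : ∀ x, σ x ≠ ∞ := fun x => hσu x ▸ ENNReal.rpow_ne_top_of_ne (hu0 x) (hut x) _
  set m := centMax (volume.withDensity σ) (fun y => f y / σ y) with hm
  have hfσ : Measurable fun y => f y / σ y := hf.div hσ
  have hmm : Measurable m := measurable_centMax _ hfσ
  set G : (Fin n → ℝ) → ℝ≥0∞ := fun z => m z ^ (r - 1) / u z with hG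
  have hGm : Measurable G := (hmm.pow_const _).div hu
  set R := centMax (volume.withDensity u) G with hR
  have hRm : Measurable R := measurable_centMax _ hGm
  calc ∫⁻ x, centMax volume f x ^ r * u x
      ≤ ∫⁻ x, (((4 ^ n) ^ r) ^ (r / (r - 1)) * A ^ (r / (r - 1))) *
          (u x * R x ^ (r / (r - 1))) := by
        refine lintegral_mono fun x => ?_
        calc centMax volume f x ^ r * u x
            ≤ ((((4 ^ n) ^ r * A) * R x) ^ (r - 1)⁻¹) ^ r * u x := by
              gcongr
              exact centMax_volume_le hu hσ hu0 hut hσ0 hσt hr hA h hf x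
          _ = _ := by
              rw [← ENNReal.rpow_mul, inv_mul_eq_div,
                ENNReal.mul_rpow_of_nonneg _ _ (by linarith),
                ENNReal.mul_rpow_of_nonneg _ _ (by linarith)]
              ring
    _ = (((4 ^ n) ^ r) ^ (r / (r - 1)) * A ^ (r / (r - 1))) *
          ∫⁻ x, R x ^ (r / (r - 1)) ∂volume.withDensity u := by
        have huR : Measurable fun x => u x * R x ^ (r / (r - 1)) := hu.mul (hRm.pow_const _)
        rw [lintegral_const_mul _ huR, lintegral_withDensity_eq_lintegral_mul _ hu (hRm.pow_const _)]
        rfl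
    _ ≤ (((4 ^ n) ^ r) ^ (r / (r - 1)) * A ^ (r / (r - 1))) * (centMaxConst n (r / (r - 1)) *
          ∫⁻ x, G x ^ (r / (r - 1)) ∂volume.withDensity u) :=
        mul_le_mul_right (lintegral_centMax_rpow_le _ hr' hGm) _
    _ = (((4 ^ n) ^ r) ^ (r / (r - 1)) * A ^ (r / (r - 1))) * (centMaxConst n (r / (r - 1)) *
          ∫⁻ x, m x ^ r ∂volume.withDensity σ) := by
        -- (m^{r-1}/u)^{r'} u = m^r u^{1-r'} = m^r σ, because 1 - r' = -1/(r-1).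
        congr 2
        rw [lintegral_withDensity_eq_lintegral_mul _ hu (hGm.pow_const _),
          lintegral_withDensity_eq_lintegral_mul _ hσ (hmm.pow_const _)]
        refine lintegral_congr fun x => ?_
        simp only [Pi.mul_apply, hG]
        rw [ENNReal.div_rpow_of_nonneg _ _ (by linarith), ← ENNReal.rpow_mul,
          mul_div_cancel₀ _ hr1.ne', hσu x, div_eq_mul_inv, ← ENNReal.rpow_neg, mul_left_comm,
          mul_comm]
        congr 1
        conv_lhs => enter [1]; rw [← ENNReal.rpow_one (u x)]
        rw [← ENNReal.rpow_add _ _ (hu0 x) (hut x)]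
        congr 1
        field_simp
        ring
    _ ≤ (((4 ^ n) ^ r) ^ (r / (r - 1)) * A ^ (r / (r - 1))) * (centMaxConst n (r / (r - 1)) *
          (centMaxConst n r * ∫⁻ x, (f x / σ x) ^ r ∂volume.withDensity σ)) :=
        mul_le_mul_right (mul_le_mul_right
          (lintegral_centMax_rpow_le _ hr hfσ) _) _
    _ = (((4 ^ n) ^ r) ^ (r / (r - 1)) * A ^ (r / (r - 1))) * (centMaxConst n (r / (r - 1)) *
          (centMaxConst n r * ∫⁻ x, f x ^ r * u x)) := by
        -- (f/σ)^r σ = f^r σ^{1-r} = f^r u.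
        congr 3
        rw [lintegral_withDensity_eq_lintegral_mul _ hσ (hfσ.pow_const _)]
        refine lintegral_congr fun x => ?_
        simp only [Pi.mul_apply]
        rw [ENNReal.div_rpow_of_nonneg _ _ (by linarith), hσu x, div_eq_mul_inv,
          ← ENNReal.rpow_neg, mul_left_comm]
        congr 1
        rw [← ENNReal.rpow_mul, ← ENNReal.rpow_add _ _ (hu0 x) (hut x)]
        conv_rhs => rw [← ENNReal.rpow_one (u x)]
        congr 1
        field_simp
        ring
    _ = _ := by ring

end Buckley

/-! ### Rubio de Francia iteration and A₁ majorants. -/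

section RubioDeFrancia

open Metric

variable {n : ℕ}

theorem measurable_iterate_centMax {v : (Fin n → ℝ) → ℝ≥0∞} (hv : Measurable v) (j : ℕ) :
    Measurable ((centMax volume)^[j] v) := by
  induction j with
  | zero => exact hv
  | succ j ih => rw [Function.iterate_succ_apply']; exact measurable_centMax _ ih

theorem centMax_tsum_le (f : ℕ → (Fin n → ℝ) → ℝ≥0∞) (hf : ∀ j, Measurable (f j))
    (x : Fin n → ℝ) :
    centMax volume (fun y => ∑' j, f j y) x ≤ ∑' j, centMax volume (f j) x := by
  refine iSup_le fun k => ?_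
  rw [lintegral_tsum fun j => (hf j).aemeasurable, div_eq_mul_inv, ← ENNReal.tsum_mul_right]
  exact ENNReal.tsum_le_tsum fun j => div_le_centMax _ _ _ _

theorem centMax_const_mul (f : (Fin n → ℝ) → ℝ≥0∞) (hf : Measurable f) (b : ℝ≥0∞)
    (x : Fin n → ℝ) : centMax volume (fun y => b * f y) x = b * centMax volume f x := by
  unfold centMax
  rw [ENNReal.mul_iSup]
  refine iSup_congr fun k => ?_
  rw [lintegral_const_mul _ hf, mul_div_assoc]

/-- Jensen's inequality for the power function and countable sums. -/
theorem ENNReal.tsum_mul_rpow_le {w a : ℕ → ℝ≥0∞} {s : ℝ} (hs : 1 ≤ s) :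
    (∑' j, w j * a j) ^ s ≤ (∑' j, w j) ^ (s - 1) * ∑' j, w j * a j ^ s := by
  have hs0 : 0 < s := by linarith
  have h : ∑' j, w j * a j ≤ ((∑' j, w j) ^ (s - 1) * ∑' j, w j * a j ^ s) ^ s⁻¹ := by
    rw [ENNReal.tsum_eq_iSup_sum]
    refine iSup_le fun t => (ENNReal.inner_le_weight_mul_Lp_of_nonneg t hs w a).trans ?_
    rw [ENNReal.mul_rpow_of_nonneg _ _ (by positivity), ← ENNReal.rpow_mul]
    have he : (s - 1) * s⁻¹ = 1 - s⁻¹ := by field_simp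
    rw [he]
    have he' : 0 ≤ 1 - s⁻¹ := sub_nonneg.2 (inv_le_one_of_one_le₀ hs)
    gcongr <;> exact ENNReal.sum_le_tsum _
  rwa [ENNReal.le_rpow_inv_iff hs0] at h

/-- The Rubio de Francia iteration algorithm. -/
theorem exists_centMax_le_mul {ρ : (Fin n → ℝ) → ℝ≥0∞} (hρ : Measurable ρ) {s : ℝ} (hs : 1 ≤ s)
    {B : ℝ≥0∞} (hB0 : B ≠ 0) (hBt : B ≠ ∞)
    (hM : ∀ f : (Fin n → ℝ) → ℝ≥0∞, Measurable f →
      ∫⁻ x, centMax volume f x ^ s * ρ x ≤ B ^ s * ∫⁻ x, f x ^ s * ρ x)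
    {v : (Fin n → ℝ) → ℝ≥0∞} (hv : Measurable v) :
    ∃ K : (Fin n → ℝ) → ℝ≥0∞, Measurable K ∧ (∀ x, v x ≤ K x) ∧
      ∫⁻ x, K x ^ s * ρ x ≤ 2 ^ s * ∫⁻ x, v x ^ s * ρ x ∧
      ∀ x, centMax volume K x ≤ 2 * B * K x := by
  have hs0 : 0 < s := by linarith
  set it : ℕ → (Fin n → ℝ) → ℝ≥0∞ := fun j => (centMax volume)^[j] v with hit
  have hitm : ∀ j, Measurable (it j) := measurable_iterate_centMax hv
  have hitL : ∀ j, ∫⁻ x, it j x ^ s * ρ x ≤ (B ^ j) ^ s * ∫⁻ x, v x ^ s * ρ x := by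
    intro j
    induction j with
    | zero => simp [hit]
    | succ j ih =>
      have h1 := hM (it j) (hitm j)
      have h2 : it (j + 1) = centMax volume (it j) := Function.iterate_succ_apply' _ _ _
      rw [h2]
      refine h1.trans ?_
      rw [pow_succ', ENNReal.mul_rpow_of_nonneg _ _ hs0.le, mul_assoc]
      exact mul_le_mul_right ih _
  -- The series Σ (2B)^{-j} M^j v. The factors 2^{-j}, of total mass 2, serve as Jensen weights and
  -- give 2^{s-1} · 2 = 2^s.
  refine ⟨fun x => ∑' j, (2 : ℝ≥0∞)⁻¹ ^ j * ((B ^ j)⁻¹ * it j x), ?_, ?_, ?_, ?_⟩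
  · exact Measurable.tsum fun j => ((hitm j).const_mul _).const_mul _
  · intro x
    refine le_trans ?_ (ENNReal.le_tsum 0)
    simp [hit]
  · calc ∫⁻ x, (∑' j, (2 : ℝ≥0∞)⁻¹ ^ j * ((B ^ j)⁻¹ * it j x)) ^ s * ρ x
        ≤ ∫⁻ x, 2 ^ (s - 1) * ∑' j, (2 : ℝ≥0∞)⁻¹ ^ j * (((B ^ j)⁻¹) ^ s * (it j x ^ s * ρ x)) := by
          refine lintegral_mono fun x => ?_
          refine (mul_le_mul_left (ENNReal.tsum_mul_rpow_le hs) _).trans ?_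
          rw [ENNReal.tsum_geometric, ENNReal.one_sub_inv_two, inv_inv, mul_assoc,
            ← ENNReal.tsum_mul_right]
          refine mul_le_mul_right (ENNReal.tsum_le_tsum fun j => ?_) _
          rw [ENNReal.mul_rpow_of_nonneg _ _ hs0.le]
          exact le_of_eq (by ring)
      _ = 2 ^ (s - 1) * ∑' j, (2 : ℝ≥0∞)⁻¹ ^ j * (((B ^ j)⁻¹) ^ s * ∫⁻ x, it j x ^ s * ρ x) := by
          have hm : ∀ j, Measurable fun x => it j x ^ s * ρ x := fun j =>
            ((hitm j).pow_const s).mul hρ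
          rw [lintegral_const_mul, lintegral_tsum]
          · simp_rw [lintegral_const_mul _ ((hm _).const_mul _), lintegral_const_mul _ (hm _)]
          · exact fun j => (((hm j).const_mul _).const_mul _).aemeasurable
          · exact Measurable.tsum fun j => ((hm j).const_mul _).const_mul _
      _ ≤ 2 ^ (s - 1) * ∑' j, (2 : ℝ≥0∞)⁻¹ ^ j * ∫⁻ x, v x ^ s * ρ x := by
          refine mul_le_mul_right (ENNReal.tsum_le_tsum fun j => mul_le_mul_right ?_ _) _
          refine (mul_le_mul_right (hitL j) _).trans ?_
          have hj0 : B ^ j ≠ 0 := pow_ne_zero _ hB0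
          have hjt : B ^ j ≠ ∞ := ENNReal.pow_ne_top hBt
          rw [← mul_assoc, ← ENNReal.mul_rpow_of_nonneg _ _ hs0.le,
            ENNReal.inv_mul_cancel hj0 hjt, ENNReal.one_rpow, one_mul]
      _ = _ := by
          rw [ENNReal.tsum_mul_right, ENNReal.tsum_geometric, ENNReal.one_sub_inv_two, inv_inv,
            ← mul_assoc]
          congr 1
          conv_lhs => enter [2]; rw [← ENNReal.rpow_one 2]
          rw [← ENNReal.rpow_add _ _ (by simp) (by simp)]
          ring_nf
  · intro x
    refine (centMax_tsum_le _ (fun j => ((hitm j).const_mul _).const_mul _) x).trans ?_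
    have h1 : ∀ j, centMax volume (fun y => (2 : ℝ≥0∞)⁻¹ ^ j * ((B ^ j)⁻¹ * it j y)) x =
        2 * B * ((2 : ℝ≥0∞)⁻¹ ^ (j + 1) * ((B ^ (j + 1))⁻¹ * it (j + 1) x)) := by
      intro j
      have h2 : it (j + 1) = centMax volume (it j) := Function.iterate_succ_apply' _ _ _
      rw [centMax_const_mul _ ((hitm j).const_mul _), centMax_const_mul _ (hitm j), h2,
        pow_succ' B, ENNReal.mul_inv (Or.inl hB0) (Or.inl hBt), pow_succ']
      calc _ = (2 * 2⁻¹) * (B * B⁻¹) *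
            ((2 : ℝ≥0∞)⁻¹ ^ j * ((B ^ j)⁻¹ * centMax volume (it j) x)) := by
            rw [ENNReal.mul_inv_cancel (by simp) (by simp), ENNReal.mul_inv_cancel hB0 hBt,
              one_mul, one_mul]
        _ = _ := by ring
    -- The series dominating MK is 2B times the series for K without its zeroth term.
    simp_rw [h1]
    rw [ENNReal.tsum_mul_left]
    refine mul_le_mul_right ?_ _
    exact ENNReal.tsum_comp_le_tsum_of_injective (add_left_injective 1)
      fun j => (2 : ℝ≥0∞)⁻¹ ^ j * ((B ^ j)⁻¹ * it j x)

theorem volume_cube (a : Fin n → ℝ) (l : ℝ) : volume (cube a l) = ENNReal.ofReal l ^ n := by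
  simp [cube, Real.volume_Icc_pi]

theorem volume_cube_ne_zero (a : Fin n → ℝ) {l : ℝ} (hl : 0 < l) : volume (cube a l) ≠ 0 := by
  rw [volume_cube]
  exact pow_ne_zero _ (by simpa using hl)

theorem volume_cube_ne_top (a : Fin n → ℝ) (l : ℝ) : volume (cube a l) ≠ ∞ := by
  rw [volume_cube]
  exact ENNReal.pow_ne_top ENNReal.ofReal_ne_top

theorem measurableSet_cube (a : Fin n → ℝ) (l : ℝ) : MeasurableSet (cube a l) :=
  measurableSet_Icc

theorem closedBall_eq_cube (x : Fin n → ℝ) {ρ : ℝ} (hρ : 0 ≤ ρ) :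
    closedBall x ρ = cube (fun i => x i - ρ) (2 * ρ) := by
  rw [closedBall_pi _ hρ, cube, ← Set.pi_univ_Icc]
  congr 1
  ext i
  rw [Real.closedBall_eq_Icc]
  ring_nf

/-- Averages over cubes are controlled by the centred maximal function. -/
theorem setLAverage_cube_le_centMax (K : (Fin n → ℝ) → ℝ≥0∞) {a : Fin n → ℝ} {l : ℝ}
    (hl : 0 < l) {x : Fin n → ℝ} (hx : x ∈ cube a l) :
    (⨍⁻ y in cube a l, K y ∂volume) ≤ 4 ^ n * centMax volume K x := by
  -- With 2^m < l ≤ 2^{m+1}, the ball of radius 2^{m+1} about x contains the cube, and its side 4 ·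
  -- 2^m is less than 4l.
  obtain ⟨m, hm1, hm2⟩ := exists_mem_Ioc_zpow hl (y := (2 : ℝ)) (by norm_num)
  set B := closedBall x ((2 : ℝ) ^ (m + 1)) with hB
  have hsub : cube a l ⊆ B := by
    intro y hy
    rw [hB, mem_closedBall, dist_pi_le_iff (by positivity)]
    intro i
    refine le_trans ?_ hm2
    rw [Real.dist_eq, abs_le]
    have h1 := hx.1 i
    have h2 := hx.2 i
    have h3 := hy.1 i
    have h4 := hy.2 i
    simp only at h2 h4
    constructor <;> linarith
  have hvol : volume B ≤ 4 ^ n * volume (cube a l) := by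
    rw [volume_cube, hB, Real.volume_pi_closedBall _ (by positivity), Fintype.card_fin,
      ← mul_pow, ENNReal.ofReal_pow (by positivity)]
    gcongr
    have : (4 : ℝ≥0∞) * ENNReal.ofReal l = ENNReal.ofReal (4 * l) := by
      rw [ENNReal.ofReal_mul (by norm_num)]; norm_num
    rw [this]
    apply ENNReal.ofReal_le_ofReal
    rw [zpow_add_one₀ (by norm_num)]
    linarith
  have h4 : (4 : ℝ≥0∞) ^ n ≠ 0 := pow_ne_zero _ (by norm_num)
  have h4' : (4 : ℝ≥0∞) ^ n ≠ ∞ := ENNReal.pow_ne_top (by norm_num)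
  rw [setLAverage_eq]
  calc (∫⁻ y in cube a l, K y) / volume (cube a l)
      ≤ (∫⁻ y in B, K y) / volume (cube a l) := by
        gcongr
    _ = 4 ^ n * (∫⁻ y in B, K y) / (4 ^ n * volume (cube a l)) :=
        (ENNReal.mul_div_mul_left _ _ h4 h4').symm
    _ ≤ 4 ^ n * (∫⁻ y in B, K y) / volume B := ENNReal.div_le_div_left hvol _
    _ = 4 ^ n * ((∫⁻ y in B, K y) / volume B) := mul_div_assoc _ _ _
    _ ≤ _ := mul_le_mul_right (div_le_centMax _ _ _ _) _

/-- A maximal function vanishing at one point kills the integral over every ball about that point,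
and these balls exhaust the space. Thus a nontrivial majorant from the iteration is positive at
every point. -/
theorem ae_eq_zero_of_centMax_le {K : (Fin n → ℝ) → ℝ≥0∞} (hK : Measurable K) {D : ℝ≥0∞}
    {x : Fin n → ℝ} (hx : centMax volume K x ≤ D * K x) (h0 : K x = 0) :
    K =ᵐ[volume] 0 := by
  rw [h0, mul_zero, nonpos_iff_eq_zero] at hx
  rw [← lintegral_eq_zero_iff hK, ← setLIntegral_univ]
  have hcov : (Set.univ : Set (Fin n → ℝ)) = ⋃ k : ℤ, closedBall x ((2 : ℝ) ^ k) := by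
    refine (Set.eq_univ_of_forall fun y => ?_).symm
    obtain ⟨k, hk⟩ := pow_unbounded_of_one_lt (dist y x) (one_lt_two (α := ℝ))
    exact Set.mem_iUnion.2 ⟨k, by rw [mem_closedBall, zpow_natCast]; exact hk.le⟩
  rw [hcov, ← nonpos_iff_eq_zero]
  refine (lintegral_iUnion_le _ _).trans ?_
  rw [nonpos_iff_eq_zero, ENNReal.tsum_eq_zero]
  intro k
  have h := div_le_centMax volume K x k
  rw [hx, nonpos_iff_eq_zero, ENNReal.div_eq_zero_iff] at h
  exact h.resolve_right (volume_closedBall_zpow_ne_top x k)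

/-- The Rubio de Francia algorithm produces everywhere positive and finite `A₁` majorants. -/
theorem exists_setLAverage_le_mul {ρ : (Fin n → ℝ) → ℝ≥0∞} (hρ : Measurable ρ)
    (hρ0 : ∀ x, ρ x ≠ 0) {s : ℝ} (hs : 1 ≤ s)
    {B : ℝ≥0∞} (hB0 : B ≠ 0) (hBt : B ≠ ∞)
    (hM : ∀ f : (Fin n → ℝ) → ℝ≥0∞, Measurable f →
      ∫⁻ x, centMax volume f x ^ s * ρ x ≤ B ^ s * ∫⁻ x, f x ^ s * ρ x)
    {v : (Fin n → ℝ) → ℝ≥0∞} (hv : Measurable v) (hv0 : ¬ v =ᵐ[volume] 0)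
    (hvt : ∫⁻ x, v x ^ s * ρ x ≠ ∞) :
    ∃ K : (Fin n → ℝ) → ℝ≥0∞, Measurable K ∧ (∀ᵐ x, v x ≤ K x) ∧
      ∫⁻ x, K x ^ s * ρ x ≤ 2 ^ s * ∫⁻ x, v x ^ s * ρ x ∧
      (∀ x, K x ≠ 0) ∧ (∀ x, K x ≠ ∞) ∧
      ∀ (a : Fin n → ℝ) (l : ℝ), 0 < l → ∀ᵐ x ∂volume.restrict (cube a l),
        (⨍⁻ y in cube a l, K y ∂volume) ≤ 4 ^ n * (2 * B) * K x := by
  have hs0 : 0 < s := by linarith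
  obtain ⟨K, hKm, hvK, hKi, hKM⟩ := exists_centMax_le_mul hρ hs hB0 hBt hM hv
  have hK0 : ∀ x, K x ≠ 0 := by
    intro x h0
    refine hv0 ?_
    filter_upwards [ae_eq_zero_of_centMax_le hKm (hKM x) h0] with y hy
    exact nonpos_iff_eq_zero.1 ((hvK y).trans hy.le)
  have hKt : ∀ᵐ x, K x < ∞ := by
    have hfin : ∫⁻ x, K x ^ s * ρ x ≠ ∞ := ne_top_of_le_ne_top
      (ENNReal.mul_ne_top (ENNReal.rpow_ne_top_of_nonneg hs0.le (by simp)) hvt) hKi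
    filter_upwards [ae_lt_top ((hKm.pow_const s).mul hρ) hfin] with x hx
    by_contra hcon
    rw [not_lt, top_le_iff] at hcon
    refine hx.ne (?_ : K x ^ s * ρ x = ∞)
    rw [hcon, ENNReal.top_rpow_of_pos hs0, ENNReal.top_mul (hρ0 x)]
  -- `K` is infinite only on a null set; the value 1 there leaves integrals and averages unchanged
  -- and makes later powers harmless.
  set K' : (Fin n → ℝ) → ℝ≥0∞ := fun x => if K x = ∞ then 1 else K x with hK'
  have hKK' : K' =ᵐ[volume] K := by
    filter_upwards [hKt] with x hx
    simp [hK', hx.ne]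
  refine ⟨K', Measurable.ite (hKm (measurableSet_singleton _)) measurable_const hKm, ?_, ?_,
    ?_, ?_, ?_⟩
  · filter_upwards [hKK'] with x hx
    rw [hx]
    exact hvK x
  · refine le_trans (le_of_eq (lintegral_congr_ae ?_)) hKi
    filter_upwards [hKK'] with x hx
    rw [hx]
  · intro x
    by_cases hx : K x = ∞
    · simp [hK', hx]
    · simpa [hK', hx] using hK0 x
  · intro x
    by_cases hx : K x = ∞
    · simp [hK', hx]
    · simp [hK', hx]
  · intro a l hl
    filter_upwards [ae_restrict_mem (measurableSet_cube a l), ae_restrict_of_ae hKK'] with x hx hxK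
    rw [hxK, setLAverage_eq, lintegral_congr_ae (ae_restrict_of_ae hKK'), ← setLAverage_eq,
      mul_assoc]
    exact (setLAverage_cube_le_centMax K hl hx).trans (mul_le_mul_right (hKM x) _)

end RubioDeFrancia

/-! ### Factorization estimates: products of powers of A_r and A₁ weights. -/

section Factorization

theorem ENNReal.rpow_mul_rpow_rpow {x y : ℝ≥0∞} (hx : x ≠ 0) (hxt : x ≠ ∞)
    (hy : y ≠ 0) (hyt : y ≠ ∞) (a b c : ℝ) :
    (x ^ a * y ^ b) ^ c = x ^ (a * c) * y ^ (b * c) := by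
  rw [ENNReal.mul_rpow_of_ne_zero (ENNReal.rpow_ne_zero_of_ne hx hxt a)
    (ENNReal.rpow_ne_zero_of_ne hy hyt b), ENNReal.rpow_mul, ENNReal.rpow_mul]

theorem ENNReal.rpow_le_rpow_neg {x y : ℝ≥0∞} (h : x ≤ y) {a : ℝ} (ha : 0 ≤ a) :
    y ^ (-a) ≤ x ^ (-a) := by
  rw [ENNReal.rpow_neg, ENNReal.rpow_neg, ENNReal.inv_le_inv]
  exact ENNReal.rpow_le_rpow h ha

variable {α : Type*} [MeasurableSpace α] {μ : Measure α} {u K : α → ℝ≥0∞}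

/-- The factorization estimate for `u K ^ {-(r₀ - r)}`, where `u` is an `A_r` weight and `K` is
an `A₁` weight, on one cube. -/
theorem lintegral_mul_rpow_neg_mul_le (hu : Measurable u) (hK : Measurable K)
    (hu0 : ∀ x, u x ≠ 0) (hut : ∀ x, u x ≠ ∞) (hK0 : ∀ x, K x ≠ 0) (hKt : ∀ x, K x ≠ ∞)
    {r r₀ : ℝ} (hr : 1 < r) (hr₀ : r < r₀) {D : ℝ≥0∞} (hD0 : D ≠ 0) (hDt : D ≠ ∞)
    (hκ0 : ∫⁻ x, K x ∂μ ≠ 0) (hκt : ∫⁻ x, K x ∂μ ≠ ∞)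
    (hA1 : ∀ᵐ x ∂μ, ∫⁻ x, K x ∂μ ≤ D * K x) :
    (∫⁻ x, u x ^ (1 : ℝ) * K x ^ (-(r₀ - r)) ∂μ) *
      (∫⁻ x, (u x ^ (1 : ℝ) * K x ^ (-(r₀ - r))) ^ (-(r₀ - 1)⁻¹) ∂μ) ^ (r₀ - 1) ≤
    D ^ (r₀ - r) * ((∫⁻ x, u x ∂μ) * (∫⁻ x, u x ^ (-(r - 1)⁻¹) ∂μ) ^ (r - 1)) := by
  set κ := ∫⁻ x, K x ∂μ
  -- The A₁ condition gives K ≥ κ/D, so the negative power of `K` is bounded by a constant.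
  have h1 : ∫⁻ x, u x ^ (1 : ℝ) * K x ^ (-(r₀ - r)) ∂μ ≤
      (κ / D) ^ (-(r₀ - r)) * ∫⁻ x, u x ∂μ := by
    rw [← lintegral_const_mul _ hu]
    refine lintegral_mono_ae ?_
    filter_upwards [hA1] with x hx
    rw [ENNReal.rpow_one, mul_comm]
    refine mul_le_mul_left (ENNReal.rpow_le_rpow_neg ?_ (by linarith)) _
    exact ENNReal.div_le_of_le_mul (by rwa [mul_comm])
  -- In the dual factor `K` has a positive power: Hölder with exponents (r-1)/(r₀-1) and
  -- (r₀-r)/(r₀-1). The powers of κ from both factors then cancel.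
  have h2 : (∫⁻ x, (u x ^ (1 : ℝ) * K x ^ (-(r₀ - r))) ^ (-(r₀ - 1)⁻¹) ∂μ) ^ (r₀ - 1) ≤
      (∫⁻ x, u x ^ (-(r - 1)⁻¹) ∂μ) ^ (r - 1) * κ ^ (r₀ - r) := by
    have hr1 : r - 1 ≠ 0 := by linarith
    have hr01 : r₀ - 1 ≠ 0 := by linarith
    calc _ = (∫⁻ x, (u x ^ (-(r - 1)⁻¹)) ^ ((r - 1) / (r₀ - 1)) *
          (K x) ^ ((r₀ - r) / (r₀ - 1)) ∂μ) ^ (r₀ - 1) := by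
          congr 1
          refine lintegral_congr fun x => ?_
          rw [ENNReal.rpow_mul_rpow_rpow (hu0 x) (hut x) (hK0 x) (hKt x), ← ENNReal.rpow_mul]
          congr 2 <;> field_simp
      _ ≤ ((∫⁻ x, u x ^ (-(r - 1)⁻¹) ∂μ) ^ ((r - 1) / (r₀ - 1)) *
            κ ^ ((r₀ - r) / (r₀ - 1))) ^ (r₀ - 1) := by
          refine ENNReal.rpow_le_rpow ?_ (by linarith)
          refine ENNReal.lintegral_mul_norm_pow_le (hu.pow_const _).aemeasurable
            hK.aemeasurable (div_nonneg (by linarith) (by linarith))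
            (div_nonneg (by linarith) (by linarith)) ?_
          field_simp
          ring
      _ = _ := by
          rw [ENNReal.mul_rpow_of_nonneg _ _ (by linarith), ← ENNReal.rpow_mul,
            ← ENNReal.rpow_mul, div_mul_cancel₀ _ hr01, div_mul_cancel₀ _ hr01]
  refine (mul_le_mul' h1 h2).trans (le_of_eq ?_)
  have h3 : (κ / D) ^ (-(r₀ - r)) * κ ^ (r₀ - r) = D ^ (r₀ - r) := by
    rw [ENNReal.rpow_neg, ← ENNReal.inv_rpow, ENNReal.inv_div (Or.inl hDt) (Or.inl hD0),
      ← ENNReal.mul_rpow_of_nonneg _ _ (by linarith), ENNReal.div_mul_cancel hκ0 hκt]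
  rw [← h3]
  ring

/-- The factorization estimate for `u ^ {(r₀ - 1) / (r - 1)} K ^ {(r - r₀) / (r - 1)}`, where `u`
is an `A_r` weight and `K` is an `A₁` weight, on one cube. -/
theorem lintegral_rpow_mul_rpow_mul_le (hu : Measurable u) (hK : Measurable K)
    (hu0 : ∀ x, u x ≠ 0) (hut : ∀ x, u x ≠ ∞) (hK0 : ∀ x, K x ≠ 0) (hKt : ∀ x, K x ≠ ∞)
    {r r₀ : ℝ} (hr₀ : 1 < r₀) (hr : r₀ < r) {D : ℝ≥0∞} (hD0 : D ≠ 0) (hDt : D ≠ ∞)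
    (hκ0 : ∫⁻ x, K x ∂μ ≠ 0) (hκt : ∫⁻ x, K x ∂μ ≠ ∞)
    (hA1 : ∀ᵐ x ∂μ, ∫⁻ x, K x ∂μ ≤ D * K x) :
    (∫⁻ x, u x ^ ((r₀ - 1) / (r - 1)) * K x ^ ((r - r₀) / (r - 1)) ∂μ) *
      (∫⁻ x, (u x ^ ((r₀ - 1) / (r - 1)) * K x ^ ((r - r₀) / (r - 1))) ^ (-(r₀ - 1)⁻¹) ∂μ) ^
        (r₀ - 1) ≤
    D ^ ((r - r₀) / (r - 1)) *
      ((∫⁻ x, u x ∂μ) * (∫⁻ x, u x ^ (-(r - 1)⁻¹) ∂μ) ^ (r - 1)) ^ ((r₀ - 1) / (r - 1)) := by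
  set κ := ∫⁻ x, K x ∂μ
  have hr1 : 0 < r - 1 := by linarith
  have hr01 : 0 < r₀ - 1 := by linarith
  have hθ0 : 0 ≤ (r₀ - 1) / (r - 1) := div_nonneg hr01.le hr1.le
  have hθ1 : 0 ≤ (r - r₀) / (r - 1) := div_nonneg (by linarith) hr1.le
  -- The roles are exchanged: Hölder handles the first factor, and K ≥ κ/D handles the dual one.
  have h1 : ∫⁻ x, u x ^ ((r₀ - 1) / (r - 1)) * K x ^ ((r - r₀) / (r - 1)) ∂μ ≤
      (∫⁻ x, u x ∂μ) ^ ((r₀ - 1) / (r - 1)) * κ ^ ((r - r₀) / (r - 1)) := by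
    refine ENNReal.lintegral_mul_norm_pow_le hu.aemeasurable hK.aemeasurable hθ0 hθ1 ?_
    field_simp
    ring
  have h2 : (∫⁻ x, (u x ^ ((r₀ - 1) / (r - 1)) * K x ^ ((r - r₀) / (r - 1))) ^
      (-(r₀ - 1)⁻¹) ∂μ) ^ (r₀ - 1) ≤
      (∫⁻ x, u x ^ (-(r - 1)⁻¹) ∂μ) ^ (r₀ - 1) * (κ / D) ^ (-((r - r₀) / (r - 1))) := by
    calc _ ≤ (∫⁻ x, (κ / D) ^ (-((r - r₀) / (r - 1) / (r₀ - 1))) * u x ^ (-(r - 1)⁻¹) ∂μ) ^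
            (r₀ - 1) := by
          refine ENNReal.rpow_le_rpow (lintegral_mono_ae ?_) hr01.le
          filter_upwards [hA1] with x hx
          rw [ENNReal.rpow_mul_rpow_rpow (hu0 x) (hut x) (hK0 x) (hKt x), mul_comm]
          have e1 : (r₀ - 1) / (r - 1) * -(r₀ - 1)⁻¹ = -(r - 1)⁻¹ := by field_simp
          have e2 : (r - r₀) / (r - 1) * -(r₀ - 1)⁻¹ = -((r - r₀) / (r - 1) / (r₀ - 1)) := by
            field_simp
          rw [e1, e2]
          refine mul_le_mul_left (ENNReal.rpow_le_rpow_neg ?_ (div_nonneg hθ1 hr01.le)) _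
          exact ENNReal.div_le_of_le_mul (by rwa [mul_comm])
      _ = _ := by
          rw [lintegral_const_mul _ (hu.pow_const _), ENNReal.mul_rpow_of_nonneg _ _ hr01.le,
            ← ENNReal.rpow_mul, mul_comm]
          congr 2
          field_simp
  refine (mul_le_mul' h1 h2).trans (le_of_eq ?_)
  have h3 : (κ / D) ^ (-((r - r₀) / (r - 1))) * κ ^ ((r - r₀) / (r - 1)) =
      D ^ ((r - r₀) / (r - 1)) := by
    rw [ENNReal.rpow_neg, ← ENNReal.inv_rpow, ENNReal.inv_div (Or.inl hDt) (Or.inl hD0),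
      ← ENNReal.mul_rpow_of_nonneg _ _ hθ1, ENNReal.div_mul_cancel hκ0 hκt]
  rw [← h3, ENNReal.mul_rpow_of_nonneg _ _ hθ0, ← ENNReal.rpow_mul (_ : ℝ≥0∞) (r - 1),
    mul_div_cancel₀ _ hr1.ne']
  ring

end Factorization

/-! ### A_{p,q}, A_r and A₁ bounds for everywhere positive and finite weights. -/

section Weights

open Metric

variable {n : ℕ}

/-- `A` bounds the `A_{p,q}` constant of the `[0, ∞]`-valued weight `V`. -/
def HasApqBound (p q : ℝ) (V : (Fin n → ℝ) → ℝ≥0∞) (A : ℝ≥0∞) : Prop :=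
  (p = 1 → ∀ (a : Fin n → ℝ) (l : ℝ), 0 < l →
    (⨍⁻ x in cube a l, V x ^ q ∂volume) ≤
      A * essInf (fun x => V x ^ q) (volume.restrict (cube a l))) ∧
  (p ≠ 1 → ∀ (a : Fin n → ℝ) (l : ℝ), 0 < l →
    (⨍⁻ x in cube a l, V x ^ q ∂volume) *
      (⨍⁻ x in cube a l, V x ^ (-dualExp p) ∂volume) ^ (q / dualExp p) ≤ A)

/-- `A` bounds the `A_r` constant of the weight `u`. -/
def HasMuckenhouptBound (r : ℝ) (u : (Fin n → ℝ) → ℝ≥0∞) (A : ℝ≥0∞) : Prop :=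
  ∀ (a : Fin n → ℝ) (l : ℝ), 0 < l →
    (⨍⁻ x in cube a l, u x ∂volume) *
      (⨍⁻ x in cube a l, u x ^ (-(r - 1)⁻¹) ∂volume) ^ (r - 1) ≤ A

theorem dualExp_pos {p : ℝ} (hp : 1 < p) : 0 < dualExp p :=
  div_pos (by linarith) (by linarith)

theorem div_dualExp {p : ℝ} (hp : 1 < p) (q : ℝ) : q / dualExp p = q * (1 - 1 / p) := by
  have : p - 1 ≠ 0 := by linarith
  have : p ≠ 0 := by linarith
  unfold dualExp
  field_simp

/-- Since r - 1 = q/p', one has (V^q)^{-1/(r-1)} = V^{-p'}, so the two conditions coincide with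
equal constants. -/
theorem HasApqBound.hasMuckenhouptBound {p q r : ℝ} (hp : 1 < p) (hq : 0 < q)
    (hr : r - 1 = q / dualExp p) {V : (Fin n → ℝ) → ℝ≥0∞} {A : ℝ≥0∞} (h : HasApqBound p q V A) :
    HasMuckenhouptBound r (fun x => V x ^ q) A := by
  intro a l hl
  have := dualExp_pos hp
  have he : q * -(q / dualExp p)⁻¹ = -dualExp p := by field_simp
  simp_rw [← ENNReal.rpow_mul, hr, he]
  exact h.2 hp.ne' a l hl

theorem HasMuckenhouptBound.hasApqBound {p q r : ℝ} (hp : 1 < p) (hq : 0 < q)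
    (hr : r - 1 = q / dualExp p) {v : (Fin n → ℝ) → ℝ≥0∞} {A : ℝ≥0∞}
    (h : HasMuckenhouptBound r v A) :
    HasApqBound p q (fun x => v x ^ (1 / q)) A := by
  refine ⟨fun hp1 => absurd hp1 hp.ne', fun _ a l hl => ?_⟩
  have := dualExp_pos hp
  have he : 1 / q * -dualExp p = -(q / dualExp p)⁻¹ := by field_simp
  simp_rw [← ENNReal.rpow_mul, he, one_div_mul_cancel hq.ne', ENNReal.rpow_one, ← hr]
  exact h a l hl

/-- The A_r condition with denominators cleared, as Lerner's argument uses it; balls in the sup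
metric are cubes. -/
theorem HasMuckenhouptBound.lintegral_closedBall_mul_le {r : ℝ} (hr : 1 < r) {u : (Fin n → ℝ) → ℝ≥0∞}
    {A : ℝ≥0∞} (h : HasMuckenhouptBound r u A) (x : Fin n → ℝ) (k : ℤ) :
    (∫⁻ y in closedBall x ((2 : ℝ) ^ k), u y) *
      (∫⁻ y in closedBall x ((2 : ℝ) ^ k), u y ^ (-(r - 1)⁻¹)) ^ (r - 1) ≤
        A * volume (closedBall x ((2 : ℝ) ^ k)) ^ r := by
  have hb0 := volume_closedBall_zpow_pos x k
  have hbt := volume_closedBall_zpow_ne_top x k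
  have hcube := closedBall_eq_cube x (ρ := (2 : ℝ) ^ k) (by positivity)
  have h1 := h (fun i => x i - (2 : ℝ) ^ k) (2 * (2 : ℝ) ^ k) (by positivity)
  rw [← hcube, setLAverage_eq, setLAverage_eq, ENNReal.div_rpow_of_nonneg _ _ (by linarith)] at h1
  set b := volume (closedBall x ((2 : ℝ) ^ k))
  have hb1 : b ^ r = b * b ^ (r - 1) := by
    conv_rhs => enter [1]; rw [← ENNReal.rpow_one b]
    rw [← ENNReal.rpow_add _ _ hb0 hbt]
    ring_nf
  have hc0 := ENNReal.rpow_ne_zero_of_ne hb0 hbt (r - 1)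
  have hct := ENNReal.rpow_ne_top_of_ne hb0 hbt (r - 1)
  rw [hb1]
  calc _ = ((∫⁻ y in closedBall x ((2 : ℝ) ^ k), u y) / b * b) *
        ((∫⁻ y in closedBall x ((2 : ℝ) ^ k), u y ^ (-(r - 1)⁻¹)) ^ (r - 1) / b ^ (r - 1) *
          b ^ (r - 1)) := by
        rw [ENNReal.div_mul_cancel hb0 hbt, ENNReal.div_mul_cancel hc0 hct]
    _ = ((∫⁻ y in closedBall x ((2 : ℝ) ^ k), u y) / b *
        ((∫⁻ y in closedBall x ((2 : ℝ) ^ k), u y ^ (-(r - 1)⁻¹)) ^ (r - 1) / b ^ (r - 1))) *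
          (b * b ^ (r - 1)) := by ring
    _ ≤ _ := mul_le_mul_left h1 _

theorem setLAverage_ne_zero {u : (Fin n → ℝ) → ℝ≥0∞} (hu : Measurable u)
    (hu0 : ∀ x, u x ≠ 0) (a : Fin n → ℝ) {l : ℝ} (hl : 0 < l) :
    (⨍⁻ x in cube a l, u x ∂volume) ≠ 0 := by
  rw [setLAverage_eq]
  exact ENNReal.div_ne_zero.2
    ⟨setLIntegral_ne_zero_of_pos hu hu0 (volume_cube_ne_zero a hl), volume_cube_ne_top a l⟩

theorem HasMuckenhouptBound.ne_zero {r : ℝ} (hr : 1 < r) {u : (Fin n → ℝ) → ℝ≥0∞}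
    (hu : Measurable u) (hu0 : ∀ x, u x ≠ 0) (hut : ∀ x, u x ≠ ∞)
    {A : ℝ≥0∞} (h : HasMuckenhouptBound r u A) : A ≠ 0 := by
  rintro rfl
  have h1 := h 0 1 one_pos
  rw [nonpos_iff_eq_zero, mul_eq_zero, ENNReal.rpow_eq_zero_iff_of_pos (by linarith)] at h1
  exact h1.elim (setLAverage_ne_zero hu hu0 0 one_pos)
    (setLAverage_ne_zero (hu.pow_const _)
      (fun x => ENNReal.rpow_ne_zero_of_ne (hu0 x) (hut x) _) 0 one_pos)

/-- `K` is an `A₁` weight with constant at most `D`. -/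
def HasA1Bound (K : (Fin n → ℝ) → ℝ≥0∞) (D : ℝ≥0∞) : Prop :=
  ∀ (a : Fin n → ℝ) (l : ℝ), 0 < l → ∀ᵐ x ∂volume.restrict (cube a l),
    (⨍⁻ y in cube a l, K y ∂volume) ≤ D * K x

/-- One point of the cube satisfying the A₁ inequality suffices, as `K` is finite there. -/
theorem HasA1Bound.setLAverage_ne_top {K : (Fin n → ℝ) → ℝ≥0∞} {D : ℝ≥0∞}
    (h : HasA1Bound K D) (hD : D ≠ ∞) (hKt : ∀ x, K x ≠ ∞) (a : Fin n → ℝ) {l : ℝ} (hl : 0 < l) :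
    (⨍⁻ x in cube a l, K x ∂volume) ≠ ∞ := by
  have hne : (ae (volume.restrict (cube a l))).NeBot := by
    rw [ae_neBot, Ne, Measure.restrict_eq_zero]
    exact volume_cube_ne_zero a hl
  obtain ⟨x, hx⟩ := (h a l hl).exists
  exact ne_top_of_le_ne_top (ENNReal.mul_ne_top hD (hKt x)) hx

theorem HasA1Bound.hasApqBound_one {q : ℝ} (hq : 0 < q) {K : (Fin n → ℝ) → ℝ≥0∞} {D : ℝ≥0∞}
    (h : HasA1Bound K D) (hD0 : D ≠ 0) (hD : D ≠ ∞) :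
    HasApqBound 1 q (fun x => K x ^ (1 / q)) D := by
  refine ⟨fun _ a l hl => ?_, fun h1 => absurd rfl h1⟩
  simp_rw [← ENNReal.rpow_mul, one_div_mul_cancel hq.ne', ENNReal.rpow_one]
  rw [mul_comm, ← ENNReal.div_le_iff hD0 hD]
  refine le_essInf_of_ae_le _ ?_
  filter_upwards [h a l hl] with x hx
  exact ENNReal.div_le_of_le_mul (by rwa [mul_comm])

/-- The one-cube estimate, applied to normalized Lebesgue measure on each cube. -/
theorem HasMuckenhouptBound.mul_rpow_neg {u K : (Fin n → ℝ) → ℝ≥0∞}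
    (hu : Measurable u) (hK : Measurable K)
    (hu0 : ∀ x, u x ≠ 0) (hut : ∀ x, u x ≠ ∞) (hK0 : ∀ x, K x ≠ 0) (hKt : ∀ x, K x ≠ ∞)
    {r r₀ : ℝ} (hr : 1 < r) (hr₀ : r < r₀) {D : ℝ≥0∞} (hD0 : D ≠ 0) (hDt : D ≠ ∞)
    (hKD : HasA1Bound K D) {A : ℝ≥0∞} (h : HasMuckenhouptBound r u A) :
    HasMuckenhouptBound r₀ (fun x => u x ^ (1 : ℝ) * K x ^ (-(r₀ - r))) (D ^ (r₀ - r) * A) := by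
  intro a l hl
  have hκ0 := setLAverage_ne_zero hK hK0 a hl
  have hκt := hKD.setLAverage_ne_top hDt hKt a hl
  have h1 := hKD a l hl
  have h2 := h a l hl
  simp only [setLAverage_eq'] at hκ0 hκt h1 h2 ⊢
  exact (lintegral_mul_rpow_neg_mul_le hu hK hu0 hut hK0 hKt hr hr₀ hD0 hDt hκ0 hκt
    (Measure.ae_smul_measure h1 _)).trans (mul_le_mul_right h2 _)

theorem HasMuckenhouptBound.rpow_mul_rpow {u K : (Fin n → ℝ) → ℝ≥0∞}
    (hu : Measurable u) (hK : Measurable K)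
    (hu0 : ∀ x, u x ≠ 0) (hut : ∀ x, u x ≠ ∞) (hK0 : ∀ x, K x ≠ 0) (hKt : ∀ x, K x ≠ ∞)
    {r r₀ : ℝ} (hr₀ : 1 < r₀) (hr : r₀ < r) {D : ℝ≥0∞} (hD0 : D ≠ 0) (hDt : D ≠ ∞)
    (hKD : HasA1Bound K D) {A : ℝ≥0∞} (h : HasMuckenhouptBound r u A) :
    HasMuckenhouptBound r₀
      (fun x => u x ^ ((r₀ - 1) / (r - 1)) * K x ^ ((r - r₀) / (r - 1)))
      (D ^ ((r - r₀) / (r - 1)) * A ^ ((r₀ - 1) / (r - 1))) := by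
  intro a l hl
  have hκ0 := setLAverage_ne_zero hK hK0 a hl
  have hκt := hKD.setLAverage_ne_top hDt hKt a hl
  have h1 := hKD a l hl
  have h2 := h a l hl
  simp only [setLAverage_eq'] at hκ0 hκt h1 h2 ⊢
  exact (lintegral_rpow_mul_rpow_mul_le hu hK hu0 hut hK0 hKt hr₀ hr hD0 hDt hκ0 hκt
    (Measure.ae_smul_measure h1 _)).trans (mul_le_mul_right
      (ENNReal.rpow_le_rpow h2 (div_nonneg (by linarith) (by linarith))) _)

/-- Sharp `A₁` majorants in `L^r(u)` for an `A_r` weight `u`. -/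
theorem exists_hasA1Bound (n : ℕ) {r : ℝ} (hr : 1 < r) :
    ∃ C : ℝ≥0∞, C ≠ 0 ∧ C ≠ ∞ ∧ ∀ u : (Fin n → ℝ) → ℝ≥0∞, Measurable u →
      (∀ x, u x ≠ 0) → (∀ x, u x ≠ ∞) → ∀ A : ℝ≥0∞, A ≠ 0 → A ≠ ∞ →
      (∀ (x : Fin n → ℝ) (k : ℤ), (∫⁻ y in closedBall x ((2 : ℝ) ^ k), u y) *
        (∫⁻ y in closedBall x ((2 : ℝ) ^ k), u y ^ (-(r - 1)⁻¹)) ^ (r - 1) ≤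
          A * volume (closedBall x ((2 : ℝ) ^ k)) ^ r) →
      ∀ S : (Fin n → ℝ) → ℝ≥0∞, Measurable S → ¬ S =ᵐ[volume] 0 → ∫⁻ x, S x ≠ ∞ →
      ∃ K : (Fin n → ℝ) → ℝ≥0∞, Measurable K ∧ (∀ x, K x ≠ 0) ∧ (∀ x, K x ≠ ∞) ∧
        (∀ᵐ x, S x ≤ K x ^ r * u x) ∧ ∫⁻ x, K x ^ r * u x ≤ 2 ^ r * ∫⁻ x, S x ∧
        HasA1Bound K (C * A ^ (r - 1)⁻¹) := by
  have hr1 : 0 < r - 1 := by linarith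
  have hr0 : 0 < r := by linarith
  obtain ⟨C, hCt, hC⟩ := exists_lintegral_centMax_rpow_mul_le n hr
  have hC1 : (C + 1) ≠ ∞ := by finiteness
  have hC0 : (C + 1) ≠ 0 := by simp
  -- 4^n passes from centred balls to cubes, 2 comes from the iteration, (C+1)^{1/r} from the
  -- operator norm. The summand 1 keeps the constant nonzero.
  refine ⟨4 ^ n * (2 * (C + 1) ^ r⁻¹), ?_, ?_, ?_⟩
  · refine mul_ne_zero (by simp) (mul_ne_zero (by simp) ?_)
    exact ENNReal.rpow_ne_zero_of_ne hC0 hC1 _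
  · exact ENNReal.mul_ne_top (by finiteness)
      (ENNReal.mul_ne_top (by simp) (ENNReal.rpow_ne_top_of_ne hC0 hC1 _))
  intro u hu hu0 hut A hA0 hAt h S hS hS0 hSt
  set B := (C + 1) ^ r⁻¹ * A ^ (r - 1)⁻¹ with hB
  have hB0 : B ≠ 0 := mul_ne_zero (ENNReal.rpow_ne_zero_of_ne hC0 hC1 _)
    (ENNReal.rpow_ne_zero_of_ne hA0 hAt _)
  have hBt : B ≠ ∞ := ENNReal.mul_ne_top (ENNReal.rpow_ne_top_of_ne hC0 hC1 _)
    (ENNReal.rpow_ne_top_of_ne hA0 hAt _)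
  have hBr : B ^ r = (C + 1) * A ^ (r / (r - 1)) := by
    rw [hB, ENNReal.rpow_mul_rpow_rpow hC0 hC1 hA0 hAt, inv_mul_cancel₀ hr0.ne',
      ENNReal.rpow_one, inv_mul_eq_div]
  have hM : ∀ f : (Fin n → ℝ) → ℝ≥0∞, Measurable f →
      ∫⁻ x, centMax volume f x ^ r * u x ≤ B ^ r * ∫⁻ x, f x ^ r * u x := by
    intro f hf
    refine (hC u _ hu (hu.pow_const _) hu0 hut (fun x => rfl) A hAt h f hf).trans ?_
    rw [hBr]
    gcongr
    exact le_self_add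
  -- The iteration starts from v = (S/u)^{1/r}, for which v^r u = S.
  have hk : ∀ x, ((S x / u x) ^ r⁻¹) ^ r * u x = S x := by
    intro x
    rw [← ENNReal.rpow_mul, inv_mul_cancel₀ hr0.ne', ENNReal.rpow_one,
      ENNReal.div_mul_cancel (hu0 x) (hut x)]
  have hvm : Measurable fun x => (S x / u x) ^ r⁻¹ := (hS.div hu).pow_const _
  obtain ⟨K, hKm, hvK, hKi, hK0, hKt, hKA⟩ := exists_setLAverage_le_mul hu hu0 hr.le hB0 hBt hM hvm
    (by
      intro h0
      refine hS0 ?_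
      filter_upwards [h0] with x hx
      rw [← hk x, hx]
      simp [ENNReal.zero_rpow_of_pos hr0]) (by simp_rw [hk]; exact hSt)
  refine ⟨K, hKm, hK0, hKt, ?_, ?_, ?_⟩
  · filter_upwards [hvK] with x hx
    rw [← hk x]
    gcongr
  · simpa only [hk] using hKi
  · intro a l hl
    filter_upwards [hKA a l hl] with x hx
    refine hx.trans (le_of_eq ?_)
    rw [hB]
    ring

end Weights

/-! ### Construction of the A_{p₀,q₀} weights. -/

section ExtrapolationWeights

variable {n : ℕ}

/-- The numbers `r = 1 + q / p'` and `r₀ = 1 + q₀ / p₀'` are proportional to `q` and `q₀`. -/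
theorem exists_mul_eq_one_add {p q p₀ q₀ : ℝ} (hp : 1 < p) (hq : 0 < q) (hq₀ : 0 < q₀)
    (h_rel : 1 / p - 1 / q = 1 / p₀ - 1 / q₀) :
    ∃ s : ℝ, q * s - 1 = q / dualExp p ∧ q₀ * s - 1 = q₀ * (1 - 1 / p₀) ∧ 1 < q * s ∧
      extrapExp p₀ q₀ p q = max 1 ((q₀ * s - 1) / (q * s - 1)) := by
  -- The witness is s = 1/q + 1/p', which `h_rel` identifies with 1/q₀ + 1/p₀'.
  have h1 : q * (1 / q + 1 - 1 / p) - 1 = q / dualExp p := by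
    rw [div_dualExp hp]
    field_simp
    ring
  have h2 : q₀ * (1 / q + 1 - 1 / p) - 1 = q₀ * (1 - 1 / p₀) := by
    have : 1 / q + 1 - 1 / p = 1 / q₀ + 1 - 1 / p₀ := by linarith
    rw [this]
    field_simp
    ring
  refine ⟨1 / q + 1 - 1 / p, h1, h2, ?_, ?_⟩
  · have := div_pos hq (dualExp_pos hp)
    linarith
  · rw [extrapExp, h1, h2]
    congr 1
    rw [div_div_eq_mul_div, mul_div_assoc]

/-- For `q < q₀`, every `S ∈ L¹` has a majorant `Z` of comparable norm such that
`ω Z ^ (1 / q₀ - 1 / q)` is an `A_{p₀,q₀}` weight. -/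
theorem exists_hasApqBound_of_lt (n : ℕ) {p q p₀ q₀ : ℝ} (hp : 1 < p) (hq : 0 < q)
    (hp₀ : 1 < p₀) (hq₀ : q < q₀) (h_rel : 1 / p - 1 / q = 1 / p₀ - 1 / q₀) :
    ∃ (C : ℝ≥0∞) (t : ℝ), C ≠ ∞ ∧ 0 ≤ t ∧ ∀ ω : (Fin n → ℝ) → ℝ≥0∞, Measurable ω →
      (∀ x, ω x ≠ 0) → (∀ x, ω x ≠ ∞) → ∀ A : ℝ≥0∞, A ≠ ∞ → HasApqBound p q ω A →
      ∀ S : (Fin n → ℝ) → ℝ≥0∞, Measurable S → ¬ S =ᵐ[volume] 0 → ∫⁻ x, S x ≠ ∞ →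
      ∃ Z : (Fin n → ℝ) → ℝ≥0∞, Measurable Z ∧ (∀ x, Z x ≠ 0) ∧ (∀ x, Z x ≠ ∞) ∧
        (∀ᵐ x, S x ≤ Z x) ∧ ∫⁻ x, Z x ≤ 2 ^ t * ∫⁻ x, S x ∧
        HasApqBound p₀ q₀ (fun x => ω x * Z x ^ (1 / q₀ - 1 / q))
          (C * A ^ extrapExp p₀ q₀ p q) := by
  have hq₀0 : 0 < q₀ := by linarith
  obtain ⟨s, hs, hs₀, hr, hext⟩ := exists_mul_eq_one_add hp hq hq₀0 h_rel
  have hs0 : 0 < s := by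
    by_contra hcon
    have : q * s ≤ 0 := mul_nonpos_of_nonneg_of_nonpos hq.le (not_lt.1 hcon)
    linarith
  have hrr₀ : q * s < q₀ * s := by gcongr
  have hr1 : 0 < q * s - 1 := by linarith
  obtain ⟨C, hC0, hCt, hC⟩ := exists_hasA1Bound n hr
  refine ⟨C ^ (q₀ * s - q * s), q * s, ENNReal.rpow_ne_top_of_ne hC0 hCt _, by linarith, ?_⟩
  intro ω hω hω0 hωt A hAt hA S hS hS0 hSt
  set u : (Fin n → ℝ) → ℝ≥0∞ := fun x => ω x ^ q with hu_def
  have hu : Measurable u := hω.pow_const q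
  have hu0 : ∀ x, u x ≠ 0 := fun x => ENNReal.rpow_ne_zero_of_ne (hω0 x) (hωt x) q
  have hut : ∀ x, u x ≠ ∞ := fun x => ENNReal.rpow_ne_top_of_ne (hω0 x) (hωt x) q
  have hAu : HasMuckenhouptBound (q * s) u A := hA.hasMuckenhouptBound hp hq hs
  have hA0 : A ≠ 0 := hAu.ne_zero hr hu hu0 hut
  obtain ⟨K, hK, hK0, hKt, hSK, hKi, hKA⟩ := hC u hu hu0 hut A hA0 hAt
    (hAu.lintegral_closedBall_mul_le hr) S hS hS0 hSt
  refine ⟨fun x => K x ^ (q * s) * u x, (hK.pow_const _).mul hu, ?_, ?_, hSK, hKi, ?_⟩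
  · exact fun x => mul_ne_zero (ENNReal.rpow_ne_zero_of_ne (hK0 x) (hKt x) _) (hu0 x)
  · exact fun x => ENNReal.mul_ne_top (ENNReal.rpow_ne_top_of_ne (hK0 x) (hKt x) _) (hut x)
  have hD0 : C * A ^ (q * s - 1)⁻¹ ≠ 0 :=
    mul_ne_zero hC0 (ENNReal.rpow_ne_zero_of_ne hA0 hAt _)
  have hDt : C * A ^ (q * s - 1)⁻¹ ≠ ∞ :=
    ENNReal.mul_ne_top hCt (ENNReal.rpow_ne_top_of_ne hA0 hAt _)
  have hv := (hAu.mul_rpow_neg hu hK hu0 hut hK0 hKt hr hrr₀ hD0 hDt hKA).hasApqBound hp₀ hq₀0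
    (by rw [hs₀, div_dualExp hp₀])
  have hV : (fun x => ω x * (K x ^ (q * s) * u x) ^ (1 / q₀ - 1 / q)) =
      fun x => (u x ^ (1 : ℝ) * K x ^ (-(q₀ * s - q * s))) ^ (1 / q₀) := by
    ext x
    rw [hu_def]
    simp only
    rw [ENNReal.rpow_mul_rpow_rpow (hK0 x) (hKt x) (hω0 x) (hωt x),
      ENNReal.rpow_mul_rpow_rpow (hu0 x) (hut x) (hK0 x) (hKt x), hu_def, ← ENNReal.rpow_mul,
      mul_left_comm, mul_comm (K x ^ _)]
    conv_lhs => enter [1, 1]; rw [← ENNReal.rpow_one (ω x)]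
    rw [← ENNReal.rpow_add _ _ (hω0 x) (hωt x)]
    congr 2
    · field_simp
      ring
    · field_simp
      ring
  -- The exponents of `A` add up to (r₀-r)/(r-1) + 1 = (r₀-1)/(r-1), the sharp power.
  have hconst : (C * A ^ (q * s - 1)⁻¹) ^ (q₀ * s - q * s) * A =
      C ^ (q₀ * s - q * s) * A ^ extrapExp p₀ q₀ p q := by
    have hmax : extrapExp p₀ q₀ p q = (q₀ * s - 1) / (q * s - 1) := by
      rw [hext, max_eq_right]
      rw [one_le_div hr1]
      linarith
    rw [hmax, ENNReal.mul_rpow_of_ne_zero hC0 (ENNReal.rpow_ne_zero_of_ne hA0 hAt _),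
      ← ENNReal.rpow_mul, mul_assoc]
    congr 1
    conv_lhs => enter [2]; rw [← ENNReal.rpow_one A]
    rw [← ENNReal.rpow_add _ _ hA0 hAt]
    congr 1
    field_simp
    ring
  rw [hV, ← hconst]
  exact hv

/-- For `q₀ < q`, every `S ∈ L¹` has a majorant `Z` of comparable norm such that
`ω Z ^ (1 / q₀ - 1 / q)` is an `A_{p₀,q₀}` weight. -/
theorem exists_hasApqBound_of_gt (n : ℕ) {p q p₀ q₀ : ℝ} (hp : 1 < p) (hq₀0 : 0 < q₀)
    (hp₀ : 1 ≤ p₀) (hq₀ : q₀ < q) (h_rel : 1 / p - 1 / q = 1 / p₀ - 1 / q₀) :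
    ∃ (C : ℝ≥0∞) (t : ℝ), C ≠ ∞ ∧ 0 ≤ t ∧ ∀ ω : (Fin n → ℝ) → ℝ≥0∞, Measurable ω →
      (∀ x, ω x ≠ 0) → (∀ x, ω x ≠ ∞) → ∀ A : ℝ≥0∞, A ≠ ∞ → HasApqBound p q ω A →
      ∀ S : (Fin n → ℝ) → ℝ≥0∞, Measurable S → ¬ S =ᵐ[volume] 0 → ∫⁻ x, S x ≠ ∞ →
      ∃ Z : (Fin n → ℝ) → ℝ≥0∞, Measurable Z ∧ (∀ x, Z x ≠ 0) ∧ (∀ x, Z x ≠ ∞) ∧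
        (∀ᵐ x, S x ≤ Z x) ∧ ∫⁻ x, Z x ≤ 2 ^ t * ∫⁻ x, S x ∧
        HasApqBound p₀ q₀ (fun x => ω x * Z x ^ (1 / q₀ - 1 / q))
          (C * A ^ extrapExp p₀ q₀ p q) := by
  have hq : 0 < q := by linarith
  obtain ⟨s, hs, hs₀, hr, hext⟩ := exists_mul_eq_one_add hp hq hq₀0 h_rel
  have hs0 : 0 < s := by
    by_contra hcon
    have : q * s ≤ 0 := mul_nonpos_of_nonneg_of_nonpos hq.le (not_lt.1 hcon)
    linarith
  have hrr₀ : q₀ * s < q * s := by gcongr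
  have hr1 : 0 < q * s - 1 := by linarith
  have hr' : 1 < q * s / (q * s - 1) := by rw [one_lt_div hr1]; linarith
  have hr'1 : q * s / (q * s - 1) - 1 = (q * s - 1)⁻¹ := by
    field_simp
    ring
  have hr₀1 : 0 ≤ q₀ * s - 1 := by
    rw [hs₀]
    have : 1 / p₀ ≤ 1 := by rw [div_le_one (by linarith)]; exact hp₀
    exact mul_nonneg hq₀0.le (by linarith)
  obtain ⟨C, hC0, hCt, hC⟩ := exists_hasA1Bound n hr'
  refine ⟨C ^ ((q * s - q₀ * s) / (q * s - 1)), q * s / (q * s - 1),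
    ENNReal.rpow_ne_top_of_ne hC0 hCt _, by linarith, ?_⟩
  intro ω hω hω0 hωt A hAt hA S hS hS0 hSt
  set u : (Fin n → ℝ) → ℝ≥0∞ := fun x => ω x ^ q with hu_def
  have hu : Measurable u := hω.pow_const q
  have hu0 : ∀ x, u x ≠ 0 := fun x => ENNReal.rpow_ne_zero_of_ne (hω0 x) (hωt x) q
  have hut : ∀ x, u x ≠ ∞ := fun x => ENNReal.rpow_ne_top_of_ne (hω0 x) (hωt x) q
  set σ : (Fin n → ℝ) → ℝ≥0∞ := fun x => u x ^ (-(q * s - 1)⁻¹) with hσ_def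
  have hσ : Measurable σ := hu.pow_const _
  have hσ0 : ∀ x, σ x ≠ 0 := fun x => ENNReal.rpow_ne_zero_of_ne (hu0 x) (hut x) _
  have hσt : ∀ x, σ x ≠ ∞ := fun x => ENNReal.rpow_ne_top_of_ne (hu0 x) (hut x) _
  have hAu : HasMuckenhouptBound (q * s) u A := hA.hasMuckenhouptBound hp hq hs
  have hA0 : A ≠ 0 := hAu.ne_zero hr hu hu0 hut
  -- Duality: the A_r condition for u raised to the power 1/(r-1) is the A_{r'} condition for σ.
  have hball : ∀ (x : Fin n → ℝ) (k : ℤ),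
      (∫⁻ y in Metric.closedBall x ((2 : ℝ) ^ k), σ y) *
        (∫⁻ y in Metric.closedBall x ((2 : ℝ) ^ k), σ y ^ (-(q * s / (q * s - 1) - 1)⁻¹)) ^
          (q * s / (q * s - 1) - 1) ≤
        A ^ (q * s - 1)⁻¹ *
          volume (Metric.closedBall x ((2 : ℝ) ^ k)) ^ (q * s / (q * s - 1)) := by
    intro x k
    have h := ENNReal.rpow_le_rpow (hAu.lintegral_closedBall_mul_le hr x k)
      (inv_pos.2 hr1).le
    have hσu : ∀ y, σ y ^ (-(q * s / (q * s - 1) - 1)⁻¹) = u y := by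
      intro y
      rw [hσ_def, ← ENNReal.rpow_mul, hr'1, inv_inv]
      have : -(q * s - 1)⁻¹ * -(q * s - 1) = 1 := by field_simp
      rw [this, ENNReal.rpow_one]
    simp_rw [hσu, hr'1]
    rw [ENNReal.mul_rpow_of_nonneg _ _ (inv_pos.2 hr1).le,
      ENNReal.mul_rpow_of_nonneg _ _ (inv_pos.2 hr1).le, ← ENNReal.rpow_mul, ← ENNReal.rpow_mul,
      mul_inv_cancel₀ hr1.ne', ENNReal.rpow_one, mul_comm, ← div_eq_mul_inv (q * s)] at h
    exact h
  obtain ⟨K, hK, hK0, hKt, hSK, hKi, hKA⟩ := hC σ hσ hσ0 hσt (A ^ (q * s - 1)⁻¹)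
    (ENNReal.rpow_ne_zero_of_ne hA0 hAt _) (ENNReal.rpow_ne_top_of_ne hA0 hAt _) hball S hS hS0 hSt
  -- As 1/(r'-1) = r-1, the A₁ constant of `K` is linear in `A`.
  rw [← ENNReal.rpow_mul, hr'1, inv_inv, inv_mul_cancel₀ hr1.ne', ENNReal.rpow_one] at hKA
  refine ⟨fun x => K x ^ (q * s / (q * s - 1)) * σ x, (hK.pow_const _).mul hσ, ?_, ?_, hSK, hKi, ?_⟩
  · exact fun x => mul_ne_zero (ENNReal.rpow_ne_zero_of_ne (hK0 x) (hKt x) _) (hσ0 x)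
  · exact fun x => ENNReal.mul_ne_top (ENNReal.rpow_ne_top_of_ne (hK0 x) (hKt x) _) (hσt x)
  have hD0 : C * A ≠ 0 := mul_ne_zero hC0 hA0
  have hDt : C * A ≠ ∞ := ENNReal.mul_ne_top hCt hAt
  have hV : (fun x => ω x * (K x ^ (q * s / (q * s - 1)) * σ x) ^ (1 / q₀ - 1 / q)) =
      fun x => (u x ^ ((q₀ * s - 1) / (q * s - 1)) *
        K x ^ ((q * s - q₀ * s) / (q * s - 1))) ^ (1 / q₀) := by
    ext x
    rw [hσ_def]
    simp only
    rw [ENNReal.rpow_mul_rpow_rpow (hK0 x) (hKt x) (hu0 x) (hut x),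
      ENNReal.rpow_mul_rpow_rpow (hu0 x) (hut x) (hK0 x) (hKt x), hu_def, ← ENNReal.rpow_mul,
      ← ENNReal.rpow_mul, mul_left_comm, mul_comm (K x ^ _)]
    conv_lhs => enter [1, 1]; rw [← ENNReal.rpow_one (ω x)]
    rw [← ENNReal.rpow_add _ _ (hω0 x) (hωt x)]
    congr 2
    · field_simp
      ring
    · field_simp
  have hmax : extrapExp p₀ q₀ p q = 1 := by
    rw [hext, max_eq_left]
    rw [div_le_one hr1]
    linarith
  rw [hV, hmax, ENNReal.rpow_one]
  -- At the endpoint p₀ = 1 one has r₀ = 1, and the new weight to the power q₀ is `K` itself.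
  rcases hp₀.eq_or_lt with rfl | hp₀
  · have hzero : q₀ * s - 1 = 0 := by rw [hs₀]; norm_num
    have hone : (q * s - q₀ * s) / (q * s - 1) = 1 := by
      rw [div_eq_one_iff_eq hr1.ne']
      linarith
    simp only [hzero, hone, zero_div, ENNReal.rpow_zero, one_mul, ENNReal.rpow_one]
    exact hKA.hasApqBound_one hq₀0 hD0 hDt
  · have hr₀ : 1 < q₀ * s := by
      have := div_pos hq₀0 (dualExp_pos hp₀)
      rw [div_dualExp hp₀, ← hs₀] at this
      linarith
    have hconst : (C * A) ^ ((q * s - q₀ * s) / (q * s - 1)) *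
        A ^ ((q₀ * s - 1) / (q * s - 1)) = C ^ ((q * s - q₀ * s) / (q * s - 1)) * A := by
      rw [ENNReal.mul_rpow_of_ne_zero hC0 hA0, mul_assoc, ← ENNReal.rpow_add _ _ hA0 hAt]
      congr 1
      conv_rhs => rw [← ENNReal.rpow_one A]
      congr 1
      field_simp
      ring
    rw [← hconst]
    exact (hAu.rpow_mul_rpow hu hK hu0 hut hK0 hKt hr₀ hrr₀ hD0 hDt hKA).hasApqBound hp₀ hq₀0
      (by rw [hs₀, div_dualExp hp₀])

end ExtrapolationWeights

/-! ### Return to the exponents (p, q) and extrapolation for pairs of functions. -/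

section Extrapolation

section General

variable {α : Type*} [MeasurableSpace α] {μ : Measure α} {ω Z F G S : α → ℝ≥0∞}

/-- On the F side Z ≥ (ωF)^p absorbs the factor Z^{-δ} pointwise; on the G side Hölder pays for
removing it with (∫ Z)^δ. -/
theorem lintegral_rpow_le_of_majorant_of_lt {p q p₀ q₀ δ t : ℝ} (hp : 0 < p)
    (hq : 0 < q) (hp₀ : 0 < p₀) (hq₀ : 0 < q₀) (hδ : 0 ≤ δ) (hδq : 1 / q₀ - 1 / q = -δ)
    (hδp : 1 / p₀ - 1 / p = -δ) (hω : Measurable ω) (hZ : Measurable Z) (hG : Measurable G)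
    (hZ0 : ∀ x, Z x ≠ 0) (hZt : ∀ x, Z x ≠ ∞) (hFZ : ∀ᵐ x ∂μ, (ω x * F x) ^ p ≤ Z x)
    (hZi : ∫⁻ x, Z x ∂μ ≤ 2 ^ t * ∫⁻ x, (ω x * F x) ^ p ∂μ) {N : ℝ≥0∞}
    (h : (∫⁻ x, (ω x * Z x ^ (1 / q₀ - 1 / q) * G x) ^ q₀ ∂μ) ^ (1 / q₀) ≤
      N * (∫⁻ x, (ω x * Z x ^ (1 / q₀ - 1 / q) * F x) ^ p₀ ∂μ) ^ (1 / p₀)) :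
    (∫⁻ x, (ω x * G x) ^ q ∂μ) ^ (1 / q) ≤
      N * 2 ^ (t * δ) * (∫⁻ x, (ω x * F x) ^ p ∂μ) ^ (1 / p) := by
  set X := ∫⁻ x, (ω x * F x) ^ p ∂μ
  rw [hδq] at h
  have hF : ∫⁻ x, (ω x * Z x ^ (-δ) * F x) ^ p₀ ∂μ ≤ X := by
    refine lintegral_mono_ae ?_
    filter_upwards [hFZ] with x hx
    have hδ0 := ENNReal.rpow_ne_zero_of_ne (hZ0 x) (hZt x) δ
    have hδt := ENNReal.rpow_ne_top_of_ne (hZ0 x) (hZt x) δ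
    have h1 : ω x * F x ≤ (ω x * F x) ^ (p / p₀) * Z x ^ δ := by
      calc ω x * F x = (ω x * F x) ^ (p / p₀) * ((ω x * F x) ^ p) ^ δ := by
            rw [← ENNReal.rpow_mul, ← ENNReal.rpow_add_of_nonneg _ _ (by positivity)
              (by positivity)]
            have : p / p₀ + p * δ = 1 := by
              have : δ = 1 / p - 1 / p₀ := by linarith
              rw [this]
              field_simp
              ring
            rw [this, ENNReal.rpow_one]
        _ ≤ _ := by gcongr
    have h2 : ω x * Z x ^ (-δ) * F x ≤ (ω x * F x) ^ (p / p₀) := by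
      rw [mul_right_comm, ENNReal.rpow_neg, ← div_eq_mul_inv]
      exact ENNReal.div_le_of_le_mul h1
    calc _ ≤ ((ω x * F x) ^ (p / p₀)) ^ p₀ := ENNReal.rpow_le_rpow h2 hp₀.le
      _ = _ := by rw [← ENNReal.rpow_mul, div_mul_cancel₀ _ hp₀.ne']
  have hqδ : q / q₀ + q * δ = 1 := by
    have : δ = 1 / q - 1 / q₀ := by linarith
    rw [this]
    field_simp
    ring
  have hG1 : ∫⁻ x, (ω x * G x) ^ q ∂μ ≤
      (∫⁻ x, (ω x * Z x ^ (-δ) * G x) ^ q₀ ∂μ) ^ (q / q₀) * (∫⁻ x, Z x ∂μ) ^ (q * δ) := by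
    refine le_trans (le_of_eq ?_) (ENNReal.lintegral_mul_norm_pow_le ?_ hZ.aemeasurable
      (by positivity) (by positivity) hqδ)
    · refine lintegral_congr fun x => ?_
      have hδ0 := ENNReal.rpow_ne_zero_of_ne (hZ0 x) (hZt x) δ
      have hδt := ENNReal.rpow_ne_top_of_ne (hZ0 x) (hZt x) δ
      rw [← ENNReal.rpow_mul, mul_div_cancel₀ _ hq₀.ne', mul_comm q δ, ENNReal.rpow_mul (Z x),
        ← ENNReal.mul_rpow_of_nonneg _ _ hq.le, mul_right_comm, mul_assoc (ω x),
        ENNReal.rpow_neg, ENNReal.inv_mul_cancel hδ0 hδt, mul_one]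
    · exact (((hω.mul (hZ.pow_const _)).mul hG).pow_const _).aemeasurable
  calc (∫⁻ x, (ω x * G x) ^ q ∂μ) ^ (1 / q)
      ≤ ((∫⁻ x, (ω x * Z x ^ (-δ) * G x) ^ q₀ ∂μ) ^ (q / q₀) *
          (∫⁻ x, Z x ∂μ) ^ (q * δ)) ^ (1 / q) := ENNReal.rpow_le_rpow hG1 (by positivity)
    _ = (∫⁻ x, (ω x * Z x ^ (-δ) * G x) ^ q₀ ∂μ) ^ (1 / q₀) * (∫⁻ x, Z x ∂μ) ^ δ := by
        rw [ENNReal.mul_rpow_of_nonneg _ _ (by positivity), ← ENNReal.rpow_mul,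
          ← ENNReal.rpow_mul]
        congr 2 <;> field_simp
    _ ≤ (N * X ^ (1 / p₀)) * (2 ^ t * X) ^ δ := by
        refine mul_le_mul' (h.trans (mul_le_mul_right ?_ _)) (ENNReal.rpow_le_rpow hZi hδ)
        exact ENNReal.rpow_le_rpow hF (by positivity)
    _ = _ := by
        rw [ENNReal.mul_rpow_of_nonneg _ _ hδ, ← ENNReal.rpow_mul]
        have : 1 / p = 1 / p₀ + δ := by linarith
        rw [this, ENNReal.rpow_add_of_nonneg _ _ (by positivity) hδ]
        ring

/-- Now Z^δ helps pointwise on the G side and costs (∫ Z)^δ by Hölder on the F side. This leaves (∫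
S)^δ on both sides, which is cancelled; hence ∫ S must be positive and finite. -/
theorem lintegral_rpow_le_of_majorant_of_gt {p q p₀ q₀ δ t : ℝ} (hp : 0 < p)
    (hq : 0 < q) (hp₀ : 0 < p₀) (hq₀ : 0 < q₀) (hδ : 0 ≤ δ) (hδq : 1 / q₀ - 1 / q = δ)
    (hδp : 1 / p₀ - 1 / p = δ) (hω : Measurable ω) (hZ : Measurable Z) (hF : Measurable F)
    (hSG : ∀ x, S x ≤ (ω x * G x) ^ q) (hSZ : ∀ᵐ x ∂μ, S x ≤ Z x)
    (hS0 : ∫⁻ x, S x ∂μ ≠ 0) (hSt : ∫⁻ x, S x ∂μ ≠ ∞)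
    (hZi : ∫⁻ x, Z x ∂μ ≤ 2 ^ t * ∫⁻ x, S x ∂μ) {N : ℝ≥0∞}
    (h : (∫⁻ x, (ω x * Z x ^ (1 / q₀ - 1 / q) * G x) ^ q₀ ∂μ) ^ (1 / q₀) ≤
      N * (∫⁻ x, (ω x * Z x ^ (1 / q₀ - 1 / q) * F x) ^ p₀ ∂μ) ^ (1 / p₀)) :
    (∫⁻ x, S x ∂μ) ^ (1 / q) ≤
      N * 2 ^ (t * δ) * (∫⁻ x, (ω x * F x) ^ p ∂μ) ^ (1 / p) := by
  set X := ∫⁻ x, (ω x * F x) ^ p ∂μ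
  set Y := ∫⁻ x, S x ∂μ
  rw [hδq] at h
  have hY : Y ≤ ∫⁻ x, (ω x * Z x ^ δ * G x) ^ q₀ ∂μ := by
    refine lintegral_mono_ae ?_
    filter_upwards [hSZ] with x hx
    calc S x = (S x ^ (1 / q) * S x ^ δ) ^ q₀ := by
          rw [← ENNReal.rpow_add_of_nonneg _ _ (by positivity) hδ, ← ENNReal.rpow_mul]
          have : (1 / q + δ) * q₀ = 1 := by
            rw [← hδq]
            field_simp
            ring
          rw [this, ENNReal.rpow_one]
      _ ≤ (((ω x * G x) ^ q) ^ (1 / q) * Z x ^ δ) ^ q₀ := by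
          gcongr
          exact hSG x
      _ = _ := by
          rw [← ENNReal.rpow_mul, mul_one_div_cancel hq.ne', ENNReal.rpow_one, mul_right_comm]
  have hpδ : p₀ / p + p₀ * δ = 1 := by
    rw [← hδp]
    field_simp
    ring
  have hF1 : ∫⁻ x, (ω x * Z x ^ δ * F x) ^ p₀ ∂μ ≤
      X ^ (p₀ / p) * (∫⁻ x, Z x ∂μ) ^ (p₀ * δ) := by
    refine le_trans (le_of_eq ?_) (ENNReal.lintegral_mul_norm_pow_le ?_ hZ.aemeasurable
      (by positivity) (by positivity) hpδ)
    · refine lintegral_congr fun x => ?_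
      rw [← ENNReal.rpow_mul, mul_div_cancel₀ _ hp.ne', mul_comm p₀ δ, ENNReal.rpow_mul (Z x),
        ← ENNReal.mul_rpow_of_nonneg _ _ hp₀.le, mul_right_comm]
    · exact ((hω.mul hF).pow_const _).aemeasurable
  have hYδ0 := ENNReal.rpow_ne_zero_of_ne hS0 hSt δ
  have hYδt := ENNReal.rpow_ne_top_of_ne hS0 hSt δ
  have key : Y ^ (1 / q) * Y ^ δ ≤ (N * 2 ^ (t * δ) * X ^ (1 / p)) * Y ^ δ := by
    calc Y ^ (1 / q) * Y ^ δ = Y ^ (1 / q₀) := by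
          rw [← ENNReal.rpow_add_of_nonneg _ _ (by positivity) hδ]
          congr 1
          linarith
      _ ≤ (∫⁻ x, (ω x * Z x ^ δ * G x) ^ q₀ ∂μ) ^ (1 / q₀) :=
          ENNReal.rpow_le_rpow hY (by positivity)
      _ ≤ N * (X ^ (p₀ / p) * (∫⁻ x, Z x ∂μ) ^ (p₀ * δ)) ^ (1 / p₀) :=
          h.trans (mul_le_mul_right (ENNReal.rpow_le_rpow hF1 (by positivity)) _)
      _ = N * (X ^ (1 / p) * (∫⁻ x, Z x ∂μ) ^ δ) := by
          rw [ENNReal.mul_rpow_of_nonneg _ _ (by positivity), ← ENNReal.rpow_mul,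
            ← ENNReal.rpow_mul]
          congr 3 <;> field_simp
      _ ≤ N * (X ^ (1 / p) * (2 ^ t * Y) ^ δ) := by gcongr
      _ = _ := by
          rw [ENNReal.mul_rpow_of_nonneg _ _ hδ, ← ENNReal.rpow_mul]
          ring
  exact (ENNReal.mul_le_mul_iff_left hYδ0 hYδt).1 key

end General

variable {n : ℕ}

/-- The integral of a measurable function is the supremum of the integrals of its truncations. -/
theorem lintegral_le_of_forall_le {φ : (Fin n → ℝ) → ℝ≥0∞} (hφ : Measurable φ) {R : ℝ≥0∞}
    (h : ∀ S : (Fin n → ℝ) → ℝ≥0∞, Measurable S → (∀ x, S x ≤ φ x) → ∫⁻ x, S x ≠ ∞ →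
      ∫⁻ x, S x ≤ R) : ∫⁻ x, φ x ≤ R := by
  set S : ℕ → (Fin n → ℝ) → ℝ≥0∞ := fun m =>
    (Metric.closedBall 0 (m : ℝ)).indicator fun x => min (φ x) m with hS
  have hSm : ∀ m, Measurable (S m) := fun m =>
    (hφ.min measurable_const).indicator Metric.isClosed_closedBall.measurableSet
  have hSφ : ∀ m x, S m x ≤ φ x := fun m x =>
    (Set.indicator_le_self' (fun _ _ => zero_le) x).trans (min_le_left _ _)
  have hmono : Monotone S := by
    intro m m' hm x
    have hm' : (m : ℝ) ≤ m' := by exact_mod_cast hm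
    refine (Set.indicator_le_indicator_of_subset (Metric.closedBall_subset_closedBall hm') (fun _ => zero_le) x).trans ?_
    refine Set.indicator_le_indicator ?_
    gcongr
  have hsup : ∀ x, φ x ≤ ⨆ m, S m x := by
    intro x
    refine le_of_forall_lt fun c hc => ?_
    obtain ⟨m₁, hm₁⟩ := ENNReal.exists_nat_gt hc.ne_top
    obtain ⟨m₂, hm₂⟩ := exists_nat_ge (dist x 0)
    refine lt_of_lt_of_le ?_ (le_iSup _ (max m₁ m₂))
    have hx : x ∈ Metric.closedBall (0 : Fin n → ℝ) ((max m₁ m₂ : ℕ) : ℝ) := by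
      rw [Metric.mem_closedBall]
      exact hm₂.trans (by exact_mod_cast le_max_right _ _)
    simp only [hS]
    rw [Set.indicator_of_mem hx]
    exact lt_min hc (hm₁.trans_le (by exact_mod_cast le_max_left _ _))
  calc ∫⁻ x, φ x ≤ ∫⁻ x, ⨆ m, S m x := lintegral_mono hsup
    _ = ⨆ m, ∫⁻ x, S m x := lintegral_iSup hSm hmono
    _ ≤ R := iSup_le fun m => by
        refine h (S m) (hSm m) (hSφ m) (ne_of_lt ?_)
        calc ∫⁻ x, S m x ≤ ∫⁻ x, (Metric.closedBall (0 : Fin n → ℝ) (m : ℝ)).indicator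
              (fun _ => (m : ℝ≥0∞)) x :=
              lintegral_mono fun x => Set.indicator_le_indicator (min_le_right _ _)
          _ < ∞ := by
              rw [lintegral_indicator_const Metric.isClosed_closedBall.measurableSet]
              exact ENNReal.mul_lt_top (by simp) measure_closedBall_lt_top

/-- Testing the hypothesis with the constant weight shows that G vanishes a.e. when F does, a case
with no nontrivial majorant. -/
theorem hasApqBound_one {p q : ℝ} : HasApqBound p q (fun _ : Fin n → ℝ => 1) 1 := by
  have hone : ∀ (a : Fin n → ℝ) (l : ℝ), 0 < l →
      (⨍⁻ _x in cube a l, (1 : ℝ≥0∞) ∂volume) = 1 := by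
    intro a l hl
    rw [setLAverage_eq, setLIntegral_one,
      ENNReal.div_self (volume_cube_ne_zero a hl) (volume_cube_ne_top a l)]
  refine ⟨fun _ a l hl => ?_, fun _ a l hl => ?_⟩
  · simp only [ENNReal.one_rpow, one_mul]
    rw [hone a l hl]
    refine le_essInf_of_ae_le _ ?_
    exact Filter.Eventually.of_forall fun _ => le_rfl
  · simp only [ENNReal.one_rpow]
    rw [hone a l hl]
    simp

/-- Weighted norm inequalities from `L^{p₀}` to `L^{q₀}` for the pair `(F, G)` with a bound by
the power `γ` of the weight constant. -/
def HasWeightedBound (p₀ q₀ γ : ℝ) (c : ℝ≥0∞) (F G : (Fin n → ℝ) → ℝ≥0∞) : Prop :=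
  ∀ V : (Fin n → ℝ) → ℝ≥0∞, Measurable V → (∀ x, V x ≠ 0) → (∀ x, V x ≠ ∞) →
    ∀ A : ℝ≥0∞, A ≠ ∞ → HasApqBound p₀ q₀ V A →
      (∫⁻ x, (V x * G x) ^ q₀) ^ (1 / q₀) ≤
        c * A ^ γ * (∫⁻ x, (V x * F x) ^ p₀) ^ (1 / p₀)

theorem exists_hasWeightedBound_of_lt (n : ℕ) {p q p₀ q₀ γ : ℝ} (hp : 1 < p) (hq : 0 < q)
    (hp₀ : 1 < p₀) (hq₀ : q < q₀) (h_rel : 1 / p - 1 / q = 1 / p₀ - 1 / q₀)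
    (hγ : 0 < γ) {c : ℝ≥0∞} (hc : c ≠ ∞) :
    ∃ C : ℝ≥0∞, C ≠ ∞ ∧ ∀ F G : (Fin n → ℝ) → ℝ≥0∞, Measurable F → Measurable G →
      HasWeightedBound p₀ q₀ γ c F G →
      HasWeightedBound p q (γ * extrapExp p₀ q₀ p q) C F G := by
  obtain ⟨C, t, hCt, ht, hC⟩ := exists_hasApqBound_of_lt n hp hq hp₀ hq₀ h_rel
  have hp₀0 : 0 < p₀ := by linarith
  have hp0 : 0 < p := by linarith
  have hq₀0 : 0 < q₀ := by linarith
  set δ := 1 / q - 1 / q₀ with hδ_def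
  have hδ : 0 < δ := sub_pos.2 (one_div_lt_one_div_of_lt hq hq₀)
  -- The summand 1 makes the constant nonzero, so that the right-hand side is really ∞ when the norm
  -- of F is.
  refine ⟨c * C ^ γ * 2 ^ (t * δ) + 1, ?_, ?_⟩
  · have h1 := ENNReal.rpow_ne_top_of_nonneg hγ.le hCt
    have h2 : (2 : ℝ≥0∞) ^ (t * δ) ≠ ∞ := ENNReal.rpow_ne_top_of_ne (by simp) (by simp) _
    finiteness
  intro F G hF hG hFG ω hω hω0 hωt A hAt hA
  have hA0 : A ≠ 0 := by
    obtain ⟨s, hs, -, hr, -⟩ := exists_mul_eq_one_add hp hq hq₀0 h_rel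
    exact (hA.hasMuckenhouptBound hp hq hs).ne_zero hr (hω.pow_const q)
      (fun x => ENNReal.rpow_ne_zero_of_ne (hω0 x) (hωt x) q)
      (fun x => ENNReal.rpow_ne_top_of_ne (hω0 x) (hωt x) q)
  have hSm : Measurable fun x => (ω x * F x) ^ p := (hω.mul hF).pow_const p
  by_cases hF0 : (fun x => (ω x * F x) ^ p) =ᵐ[volume] 0
  · have hFz : F =ᵐ[volume] 0 := by
      filter_upwards [hF0] with x hx
      have := (ENNReal.rpow_eq_zero_iff_of_pos hp0).1 hx
      exact (mul_eq_zero.1 this).resolve_left (hω0 x)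
    have h1 := hFG (fun _ => 1) measurable_const (by simp) (by simp) 1 (by simp) hasApqBound_one
    have h2 : ∫⁻ x, (1 * F x) ^ p₀ = 0 := by
      rw [lintegral_eq_zero_iff ((hF.const_mul 1).pow_const _)]
      filter_upwards [hFz] with x hx
      simp [hx, ENNReal.zero_rpow_of_pos hp₀0]
    rw [h2, ENNReal.zero_rpow_of_pos (by positivity), mul_zero, nonpos_iff_eq_zero,
      ENNReal.rpow_eq_zero_iff_of_pos (by positivity),
      lintegral_eq_zero_iff ((hG.const_mul 1).pow_const _)] at h1
    have h3 : ∫⁻ x, (ω x * G x) ^ q = 0 := by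
      have hωG : Measurable fun x => (ω x * G x) ^ q := (hω.mul hG).pow_const q
      rw [lintegral_eq_zero_iff hωG]
      filter_upwards [h1] with x hx
      have := (ENNReal.rpow_eq_zero_iff_of_pos hq₀0).1 hx
      rw [one_mul] at this
      simp [this, ENNReal.zero_rpow_of_pos hq]
    rw [h3, ENNReal.zero_rpow_of_pos (by positivity)]
    exact zero_le
  by_cases hFt : ∫⁻ x, (ω x * F x) ^ p = ∞
  · rw [hFt, ENNReal.top_rpow_of_pos (by positivity), ENNReal.mul_top]
    · exact le_top
    · exact mul_ne_zero (by simp) (ENNReal.rpow_ne_zero_of_ne hA0 hAt _)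
  obtain ⟨Z, hZ, hZ0, hZt, hSZ, hZi, hV⟩ := hC ω hω hω0 hωt A hAt hA _ hSm hF0 hFt
  have h1 := hFG _ (hω.mul (hZ.pow_const _))
    (fun x => mul_ne_zero (hω0 x) (ENNReal.rpow_ne_zero_of_ne (hZ0 x) (hZt x) _))
    (fun x => ENNReal.mul_ne_top (hωt x) (ENNReal.rpow_ne_top_of_ne (hZ0 x) (hZt x) _))
    _ (ENNReal.mul_ne_top hCt (ENNReal.rpow_ne_top_of_ne hA0 hAt _)) hV
  refine (lintegral_rpow_le_of_majorant_of_lt hp0 hq hp₀0 hq₀0 hδ.le (by rw [hδ_def]; ring)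
    (by rw [hδ_def]; linarith) hω hZ hG hZ0 hZt hSZ hZi h1).trans ?_
  refine mul_le_mul_left ?_ _
  rw [ENNReal.mul_rpow_of_nonneg _ _ hγ.le, ← ENNReal.rpow_mul, mul_comm _ γ]
  calc _ = c * C ^ γ * 2 ^ (t * δ) * A ^ (γ * extrapExp p₀ q₀ p q) := by ring
    _ ≤ _ := mul_le_mul_left le_self_add _

theorem exists_hasWeightedBound_of_gt (n : ℕ) {p q p₀ q₀ γ : ℝ} (hp : 1 < p) (hq₀0 : 0 < q₀)
    (hp₀ : 1 ≤ p₀) (hq₀ : q₀ < q) (h_rel : 1 / p - 1 / q = 1 / p₀ - 1 / q₀)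
    (hγ : 0 < γ) {c : ℝ≥0∞} (hc : c ≠ ∞) :
    ∃ C : ℝ≥0∞, C ≠ ∞ ∧ ∀ F G : (Fin n → ℝ) → ℝ≥0∞, Measurable F → Measurable G →
      HasWeightedBound p₀ q₀ γ c F G →
      HasWeightedBound p q (γ * extrapExp p₀ q₀ p q) C F G := by
  obtain ⟨C, t, hCt, ht, hC⟩ := exists_hasApqBound_of_gt n hp hq₀0 hp₀ hq₀ h_rel
  have hp₀0 : 0 < p₀ := by linarith
  have hp0 : 0 < p := by linarith
  have hq : 0 < q := by linarith
  set δ := 1 / q₀ - 1 / q with hδ_def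
  have hδ : 0 < δ := sub_pos.2 (one_div_lt_one_div_of_lt hq₀0 hq₀)
  refine ⟨c * C ^ γ * 2 ^ (t * δ), ?_, ?_⟩
  · have h1 := ENNReal.rpow_ne_top_of_nonneg hγ.le hCt
    have h2 : (2 : ℝ≥0∞) ^ (t * δ) ≠ ∞ := ENNReal.rpow_ne_top_of_ne (by simp) (by simp) _
    finiteness
  intro F G hF hG hFG ω hω hω0 hωt A hAt hA
  have hA0 : A ≠ 0 := by
    obtain ⟨s, hs, -, hr, -⟩ := exists_mul_eq_one_add hp hq hq₀0 h_rel
    exact (hA.hasMuckenhouptBound hp hq hs).ne_zero hr (hω.pow_const q)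
      (fun x => ENNReal.rpow_ne_zero_of_ne (hω0 x) (hωt x) q)
      (fun x => ENNReal.rpow_ne_top_of_ne (hω0 x) (hωt x) q)
  rw [one_div q, ENNReal.rpow_inv_le_iff hq]
  -- ‖ωG‖_q is not known to be finite, so the argument is run on integrable S ≤ (ωG)^q.
  refine lintegral_le_of_forall_le ((hω.mul hG).pow_const q) fun S hS hSG hSt => ?_
  rw [← ENNReal.rpow_inv_le_iff hq, ← one_div q]
  by_cases hS0 : S =ᵐ[volume] 0
  · rw [(lintegral_eq_zero_iff hS).2 hS0, ENNReal.zero_rpow_of_pos (by positivity)]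
    exact zero_le
  obtain ⟨Z, hZ, hZ0, hZt, hSZ, hZi, hV⟩ := hC ω hω hω0 hωt A hAt hA S hS hS0 hSt
  have h1 := hFG _ (hω.mul (hZ.pow_const _))
    (fun x => mul_ne_zero (hω0 x) (ENNReal.rpow_ne_zero_of_ne (hZ0 x) (hZt x) _))
    (fun x => ENNReal.mul_ne_top (hωt x) (ENNReal.rpow_ne_top_of_ne (hZ0 x) (hZt x) _))
    _ (ENNReal.mul_ne_top hCt (ENNReal.rpow_ne_top_of_ne hA0 hAt _)) hV
  refine (lintegral_rpow_le_of_majorant_of_gt hp0 hq hp₀0 hq₀0 hδ.le hδ_def.symm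
    (by rw [hδ_def]; linarith) hω hZ hF hSG hSZ
    (fun h => hS0 ((lintegral_eq_zero_iff hS).1 h)) hSt hZi h1).trans (le_of_eq ?_)
  rw [ENNReal.mul_rpow_of_nonneg _ _ hγ.le, ← ENNReal.rpow_mul, mul_comm _ γ]
  ring

theorem extrapExp_self {p q : ℝ} (hp : 1 < p) (hq : 0 < q) : extrapExp p q p q = 1 := by
  rw [extrapExp, ← div_dualExp hp, div_mul_div_cancel₀ (dualExp_pos hp).ne', div_self hq.ne',
    max_self]

/-- Sharp off-diagonal extrapolation for a pair of nonnegative functions. -/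
theorem exists_hasWeightedBound (n : ℕ) {p q p₀ q₀ γ : ℝ} (hp : 1 < p) (hpq : p ≤ q)
    (hp₀ : 1 ≤ p₀) (hpq₀ : p₀ ≤ q₀) (h_rel : 1 / p - 1 / q = 1 / p₀ - 1 / q₀)
    (hγ : 0 < γ) {c : ℝ≥0∞} (hc : c ≠ ∞) :
    ∃ C : ℝ≥0∞, C ≠ ∞ ∧ ∀ F G : (Fin n → ℝ) → ℝ≥0∞, Measurable F → Measurable G →
      HasWeightedBound p₀ q₀ γ c F G →
      HasWeightedBound p q (γ * extrapExp p₀ q₀ p q) C F G := by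
  have hp0 : 0 < p := by linarith
  have hp₀0 : 0 < p₀ := by linarith
  have hq : 0 < q := by linarith
  have hq₀0 : 0 < q₀ := by linarith
  rcases lt_trichotomy q q₀ with h | rfl | h
  · have h1 := one_div_lt_one_div_of_lt hq h
    have h2 : p < p₀ := (one_div_lt_one_div hp₀0 hp0).1 (by linarith)
    exact exists_hasWeightedBound_of_lt n hp hq (hp.trans h2) h h_rel hγ hc
  · have h1 : p = p₀ := by
      rw [← inv_inj, ← one_div, ← one_div]
      linarith
    subst h1
    rw [extrapExp_self hp hq, mul_one]
    exact ⟨c, hc, fun F G _ _ h => h⟩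
  · exact exists_hasWeightedBound_of_gt n hp hq₀0 hp₀ h h_rel hγ hc

/-! ### From operators and real-valued weights to pairs of [0, ∞]-valued functions. -/

theorem weightedNorm_eq {𝕜 : Type*} [RCLike 𝕜] {p : ℝ} (hp : 0 < p) {w : (Fin n → ℝ) → ℝ}
    {f : (Fin n → ℝ) → 𝕜} {ω F : (Fin n → ℝ) → ℝ≥0∞} (hw : ∀ᵐ x, 0 < w x)
    (hω : ∀ᵐ x, ENNReal.ofReal (w x) = ω x) (hF : ∀ᵐ x, ‖f x‖ₑ = F x) :
    weightedNorm p w f = (∫⁻ x, (ω x * F x) ^ p) ^ (1 / p) := by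
  rw [weightedNorm, eLpNorm_eq_lintegral_rpow_enorm_toReal (by simpa using hp) ENNReal.ofReal_ne_top,
    ENNReal.toReal_ofReal hp.le]
  congr 1
  refine lintegral_congr_ae ?_
  filter_upwards [hw, hω, hF] with x h1 h2 h3
  rw [enorm_smul, h3, Real.enorm_of_nonneg h1.le, h2]

theorem HasApqBound.apqConst_le {p q : ℝ} {V : (Fin n → ℝ) → ℝ≥0∞} (hVt : ∀ x, V x ≠ ∞)
    {A : ℝ≥0∞} (h : HasApqBound p q V A) : apqConst p q (fun x => (V x).toReal) ≤ A := by
  have hV : ∀ x, ENNReal.ofReal (V x).toReal = V x := fun x => ENNReal.ofReal_toReal (hVt x)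
  unfold apqConst
  split_ifs with hp
  · refine sInf_le ?_
    intro a l hl
    simp_rw [hV]
    exact h.1 hp a l hl
  · refine iSup_le fun a => iSup_le fun l => iSup_le fun hl => ?_
    simp_rw [hV]
    exact h.2 hp a l hl

theorem hasApqBound_apqConst {p q : ℝ} (hp : 1 < p) {w : (Fin n → ℝ) → ℝ}
    {ω : (Fin n → ℝ) → ℝ≥0∞} (hω : ∀ᵐ x, ENNReal.ofReal (w x) = ω x) :
    HasApqBound p q ω (apqConst p q w) := by
  refine ⟨fun h => absurd h hp.ne', fun _ a l hl => ?_⟩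
  have hcongr : ∀ e : ℝ, (⨍⁻ x in cube a l, ω x ^ e ∂volume) =
      ⨍⁻ x in cube a l, ENNReal.ofReal (w x) ^ e ∂volume := by
    intro e
    refine laverage_congr (ae_restrict_of_ae ?_)
    filter_upwards [hω] with x hx
    rw [hx]
  rw [hcongr, hcongr, apqConst, if_neg hp.ne']
  exact le_iSup_of_le a (le_iSup_of_le l (le_iSup_of_le hl le_rfl))

end Extrapolation

theorem theorem2p1 {𝕜 : Type*} [RCLike 𝕜] (n : ℕ) (hn : 0 < n)
    (p₀ q₀ : ℝ) (hp₀ : 1 ≤ p₀) (hpq₀ : p₀ ≤ q₀)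
    (γ : ℝ) (hγ : 0 < γ) (c : ℝ≥0) (hc : 0 < c)
    (p q : ℝ) (hp : 1 < p) (hpq : p ≤ q) (h_rel : 1 / p - 1 / q = 1 / p₀ - 1 / q₀) :
    ∃ C : ℝ≥0, ∀ (D : Set ((Fin n → ℝ) → 𝕜)) (T : D → (Fin n → ℝ) → 𝕜),
      (∀ f : D, AEStronglyMeasurable (f : (Fin n → ℝ) → 𝕜) volume) →
      (∀ f : D, AEStronglyMeasurable (T f) volume) →
      (∀ w : (Fin n → ℝ) → ℝ, IsApq p₀ q₀ w → ∀ f : D,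
        weightedNorm q₀ w (T f) ≤
          c * apqConst p₀ q₀ w ^ γ * weightedNorm p₀ w (f : (Fin n → ℝ) → 𝕜)) →
      ∀ w : (Fin n → ℝ) → ℝ, IsApq p q w → ∀ f : D,
        weightedNorm q w (T f) ≤
          C * apqConst p q w ^ (γ * extrapExp p₀ q₀ p q) *
            weightedNorm p w (f : (Fin n → ℝ) → 𝕜) := by
  obtain ⟨C, hCt, hC⟩ := exists_hasWeightedBound n hp hpq hp₀ hpq₀ h_rel hγ
    (ENNReal.coe_ne_top (r := c))
  refine ⟨C.toNNReal, fun D T hD hT h w hw f => ?_⟩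
  rw [ENNReal.coe_toNNReal hCt]
  have hfm := (hD f).enorm
  have hTm := (hT f).enorm
  set w' := hw.isWeight.aemeasurable.mk w with hw'_def
  have hw'm : Measurable w' := hw.isWeight.aemeasurable.measurable_mk
  -- A Borel version of w, set to 1 where it is not positive. Norms and averages only see a.e.
  -- classes.
  set ω : (Fin n → ℝ) → ℝ≥0∞ := fun x => if 0 < w' x then ENNReal.ofReal (w' x) else 1 with hω_def
  have hωm : Measurable ω := Measurable.ite (measurableSet_lt measurable_const hw'm)
    hw'm.ennreal_ofReal measurable_const
  have hω : ∀ᵐ x, ENNReal.ofReal (w x) = ω x := by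
    filter_upwards [hw.isWeight.aemeasurable.ae_eq_mk, hw.isWeight.pos] with x hx hpos
    rw [hx] at hpos ⊢
    exact (if_pos hpos).symm
  have hω0 : ∀ x, ω x ≠ 0 := by
    intro x
    simp only [hω_def]
    split_ifs with hx
    · simpa using hx
    · exact one_ne_zero
  have hωt : ∀ x, ω x ≠ ∞ := by
    intro x
    simp only [hω_def]
    split_ifs
    · exact ENNReal.ofReal_ne_top
    · exact ENNReal.one_ne_top
  rw [weightedNorm_eq (by linarith) hw.isWeight.pos hω hTm.ae_eq_mk,
    weightedNorm_eq (by linarith) hw.isWeight.pos hω hfm.ae_eq_mk]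
  refine hC _ _ hfm.measurable_mk hTm.measurable_mk ?_ ω hωm hω0 hωt _ hw.const_lt_top.ne
    (hasApqBound_apqConst hp hω)
  -- Conversely, each positive finite `V` gives the real weight `(V x).toReal`, to which the
  -- hypothesis on T applies; its constant is at most `A`.
  intro V hV hV0 hVt A hAt hA
  have hpos : ∀ᵐ x, 0 < (V x).toReal := ae_of_all _ fun x => ENNReal.toReal_pos (hV0 x) (hVt x)
  have hle := hA.apqConst_le hVt
  have h1 := h (fun x => (V x).toReal)
    ⟨⟨hV.ennreal_toReal.aemeasurable, hpos⟩, hle.trans_lt hAt.lt_top⟩ f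
  have hVr : ∀ᵐ x, ENNReal.ofReal (V x).toReal = V x :=
    ae_of_all _ fun x => ENNReal.ofReal_toReal (hVt x)
  rw [weightedNorm_eq (by linarith) hpos hVr hTm.ae_eq_mk,
    weightedNorm_eq (by linarith) hpos hVr hfm.ae_eq_mk] at h1
  refine h1.trans ?_
  gcongr
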